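/- **Theorem 2.1.** Let $N\ge 1$, $n\ge 1$, let $a_1,\dots,a_n\in\mathbb R^N$, and let $$V(x)=\frac12\sum_{\substack{i,j=1\\ i\ne j}}^{n}\frac{|a_i-a_j|^2}{|x-a_i|^2\,|x-a_j|^2}.$$ Let $\mu$ be a weight function on $\mathbb R^N$ and write $d\mu=\mu(x)\,dx$. Assume: * $H_1)$ $\sqrt\mu\in H^1_{loc}(\mathbb R^N)$, and $\mu>0$ almost everywhere with $\mu^{-1}\in L^1_{loc}(\mathbb R^N)$; * $H_2)$ $C_\mu,K_\mu\in\mathbb R$ are constants with $K_\mu>2-N$ such that, with $\beta=\frac{N+K_\mu-2}{n}$ and $\nabla\mu$ the weak gradient of $\mu$, for almost every $x\in\mathbb R^N$ $$W(x):=-\sum_{i=1}^n\frac{\beta}{|x-a_i|^2}\left[(x-a_i)\cdot\frac{\nabla\mu(x)}{\mu(x)}-K_\mu\right]\le C_\mu .$$ Let $H^1_\mu$ be the space of real functions $\varphi\in L^2(\mathbb R^N,\mu\,dx)$ whose weak gradient $\nabla\varphi$ belongs to $L^2(\mathbb R^N,\mu\,dx)$, and let $c_{N,\mu}=\frac{(N+K_\mu-2)^2}{n^2}$.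 Then for every $\varphi\in H^1_\mu$ the functions $V\varphi^2$ and $W\varphi^2$ are integrable with respect to $\mu\,dx$, and $$c_{N,\mu}\int_{\mathbb R^N}V\varphi^2\,d\mu\le\int_{\mathbb R^N}|\nabla\varphi|^2\,d\mu+\int_{\mathbb R^N}W\varphi^2\,d\mu .$$ As a consequence, for every $\varphi\in H^1_\mu$, $$c_{N,\mu}\int_{\mathbb R^N}V\varphi^2\,d\mu\le\int_{\mathbb R^N}|\nabla\varphi|^2\,d\mu+C_\mu\int_{\mathbb R^N}\varphi^2\,d\mu .$$ -/

import Mathlib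

open MeasureTheory
open scoped ContDiff

noncomputable section

namespace MultipolarHardy

/-- `g` is the weak (distributional) gradient of `u` on `ℝ^N`: both are locally integrable and
`∫ u ∂ᵢψ dx = - ∫ gᵢ ψ dx` for every test function `ψ ∈ C_c^∞(ℝ^N)` and every `i`. -/
def HasWeakGradient {N : ℕ} (u : EuclideanSpace ℝ (Fin N) → ℝ)
    (g : EuclideanSpace ℝ (Fin N) → EuclideanSpace ℝ (Fin N)) : Prop :=
  LocallyIntegrable u ∧ LocallyIntegrable g ∧
    ∀ ψ : EuclideanSpace ℝ (Fin N) → ℝ, ContDiff ℝ ∞ ψ → HasCompactSupport ψ →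
      ∀ i : Fin N,
        ∫ x, u x * fderiv ℝ ψ x (EuclideanSpace.single i 1) = - ∫ x, g x i * ψ x

open Classical in
/-- The weak gradient `∇u` of `u` (a representative; it is unique almost everywhere).
It is `0` by convention when `u` has no weak gradient. -/
def weakGrad {N : ℕ} (u : EuclideanSpace ℝ (Fin N) → ℝ) :
    EuclideanSpace ℝ (Fin N) → EuclideanSpace ℝ (Fin N) :=
  if h : ∃ g, HasWeakGradient u g then h.choose else 0

/-- The space `H¹_loc(ℝ^N)`: functions in `L²_loc` with weak gradient in `L²_loc`. -/
def MemH1Loc {N : ℕ} (u : EuclideanSpace ℝ (Fin N) → ℝ) : Prop :=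
  (∀ s : Set (EuclideanSpace ℝ (Fin N)), IsCompact s → MemLp u 2 (volume.restrict s)) ∧
    ∃ g, HasWeakGradient u g ∧
      ∀ s : Set (EuclideanSpace ℝ (Fin N)), IsCompact s → MemLp g 2 (volume.restrict s)

/-- The measure `dμ = μ(x) dx` attached to a weight function `μ`. -/
def weightMeasure {N : ℕ} (μ : EuclideanSpace ℝ (Fin N) → ℝ) :
    Measure (EuclideanSpace ℝ (Fin N)) :=
  volume.withDensity (fun x => ENNReal.ofReal (μ x))

/-- The weighted Sobolev space `H¹_μ = H¹(ℝ^N, μ(x) dx)`: functions in `L²_μ` whose weak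
derivatives belong to `L²_μ`. -/
def MemH1Weighted {N : ℕ} (μ φ : EuclideanSpace ℝ (Fin N) → ℝ) : Prop :=
  MemLp φ 2 (weightMeasure μ) ∧
    ∃ g, HasWeakGradient φ g ∧ MemLp g 2 (weightMeasure μ)

/-- Condition `H₁`: `√μ ∈ H¹_loc(ℝ^N)` and `μ⁻¹ ∈ L¹_loc(ℝ^N)`. The latter is understood with
`0⁻¹ = ∞`, so it contains `μ > 0` almost everywhere, which is spelled out because in Lean the
real number `0⁻¹` is `0`. -/
structure CondH1 {N : ℕ} (μ : EuclideanSpace ℝ (Fin N) → ℝ) : Prop where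
  sqrt_mem : MemH1Loc (fun x => Real.sqrt (μ x))
  pos : ∀ᵐ x, 0 < μ x
  inv_locInt : LocallyIntegrable (fun x => (μ x)⁻¹)

/-- `β = (N + K_μ - 2) / n`. -/
def betaConst (N n : ℕ) (K : ℝ) : ℝ := ((N : ℝ) + K - 2) / n

/-- `c_{N,μ} = (N + K_μ - 2)² / n²`. -/
def hardyConst (N n : ℕ) (K : ℝ) : ℝ := ((N : ℝ) + K - 2) ^ 2 / (n : ℝ) ^ 2

/-- `V(x) = ½ ∑_{i ≠ j} |aᵢ - aⱼ|² / (|x - aᵢ|² |x - aⱼ|²)`. -/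
def potentialV {N n : ℕ} (a : Fin n → EuclideanSpace ℝ (Fin N))
    (x : EuclideanSpace ℝ (Fin N)) : ℝ :=
  (1 / 2) * ∑ i : Fin n, ∑ j : Fin n,
    if i ≠ j then ‖a i - a j‖ ^ 2 / (‖x - a i‖ ^ 2 * ‖x - a j‖ ^ 2) else 0

/-- `W(x) = - ∑ᵢ β / |x - aᵢ|² [(x - aᵢ) · ∇μ(x) / μ(x) - K_μ]`, where `β = (N + K_μ - 2) / n`
and `∇μ` is the weak gradient of `μ`. -/
def functionW {N n : ℕ} (μ : EuclideanSpace ℝ (Fin N) → ℝ)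
    (a : Fin n → EuclideanSpace ℝ (Fin N)) (K : ℝ) (x : EuclideanSpace ℝ (Fin N)) : ℝ :=
  - ∑ i : Fin n, betaConst N n K / ‖x - a i‖ ^ 2 *
      (inner ℝ (x - a i) (weakGrad μ x) / μ x - K)

/-- Condition `H₂` with the constants `C = C_μ` and `K = K_μ`: `K_μ > 2 - N` and `W ≤ C_μ`
almost everywhere. -/
structure CondH2 {N n : ℕ} (μ : EuclideanSpace ℝ (Fin N) → ℝ)
    (a : Fin n → EuclideanSpace ℝ (Fin N)) (C K : ℝ) : Prop where
  lt_K : 2 - (N : ℝ) < K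
  W_le : ∀ᵐ x, functionW μ a K x ≤ C

end MultipolarHardy

end

/-!
Let `F = β ∑ⱼ (x - aⱼ) / |x - aⱼ|²`. Off the poles `div F = β (N - 2) ∑ⱼ 1 / |x - aⱼ|²` and, by
polarization, `|F|² = β² (n ∑ⱼ 1 / |x - aⱼ|² - V)`. Since `β n = N + K - 2`, these combine to
`|F|² - div F - F · ∇μ / μ = W - β² V`, and the inequality is the expansion of
`0 ≤ ∫ |∇φ + φ F|² dμ` after integrating the mixed term by parts.

To make this rigorous, `F` is replaced by `θ F`, where the cutoff `θ` is the product of a cutoff at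
infinity with an increasing function of `∏ⱼ |x - aⱼ|²` that vanishes near the poles. As `F` is a
positive multiple of the gradient of `log ∏ⱼ |x - aⱼ|²`, the derivative of the second factor along
`F` is nonnegative, and `θ² ≤ θ`; both errors have the favourable sign,
and the cutoff at infinity, at scale `R`, costs only `O(1 / R)`
(`neg_le_fderiv_fieldCutoff_poleField`, `fieldCutoff_mul_le`). Multiplying all poles by the same
cutoff matters, because the bound `W ≤ C` concerns only the sum over the poles. The function `φ` is
replaced by a bounded smooth truncation `T(φ)` with `|T'| ≤ 1`, for which `T(φ)² μ` is weakly
differentiable (`integral_comp_mul_sq_mul_fderiv`); this rests on mollification and on writing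
`μ = (√μ)²`. The resulting energy inequality (`integral_trunc_sq_mul_le`) passes to the limit by
Fatou's lemma, because `β² V + |C| - W ≥ 0` (`hardy_inequality_volume`). This yields the
integrability of `V φ²` and `W φ²` along with the inequality.
-/

namespace MultipolarHardy

open Filter Topology Convolution

/-! ### Mollification -/

/-- Bump functions supported in the ball of radius `1 / (m + 1)`. The ratio of the two radii is
kept fixed, as the almost everywhere convergence of mollifications requires. -/
noncomputable def mollifier (N m : ℕ) : ContDiffBump (0 : EuclideanSpace ℝ (Fin N)) where
  rIn := 1 / (2 * ((m : ℝ) + 1))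
  rOut := 1 / ((m : ℝ) + 1)
  rIn_pos := by positivity
  rIn_lt_rOut := by
    apply one_div_lt_one_div_of_lt <;> [positivity; nlinarith [(Nat.cast_nonneg m : (0 : ℝ) ≤ m)]]

/-- The mollification `ρₘ ⋆ f`. -/
noncomputable def mollify {N : ℕ} (m : ℕ) (f : EuclideanSpace ℝ (Fin N) → ℝ) :
    EuclideanSpace ℝ (Fin N) → ℝ :=
  (mollifier N m).normed volume ⋆[ContinuousLinearMap.lsmul ℝ ℝ, volume] f

variable {N : ℕ}

lemma mollify_apply (m : ℕ) (f : EuclideanSpace ℝ (Fin N) → ℝ) (x : EuclideanSpace ℝ (Fin N)) :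
    mollify m f x = ∫ t, (mollifier N m).normed volume t * f (x - t) := by
  simp [mollify, convolution_def]

lemma mollify_apply_swap (m : ℕ) (f : EuclideanSpace ℝ (Fin N) → ℝ)
    (x : EuclideanSpace ℝ (Fin N)) :
    mollify m f x = ∫ t, (mollifier N m).normed volume (x - t) * f t := by
  rw [mollify, convolution_eq_swap]
  simp

lemma contDiff_mollify (m : ℕ) {f : EuclideanSpace ℝ (Fin N) → ℝ} (hf : LocallyIntegrable f) :
    ContDiff ℝ ∞ (mollify m f) :=
  (mollifier N m).hasCompactSupport_normed.contDiff_convolution_left _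
    (mollifier N m).contDiff_normed hf

lemma ae_tendsto_mollify {f : EuclideanSpace ℝ (Fin N) → ℝ} (hf : LocallyIntegrable f) :
    ∀ᵐ x, Tendsto (fun m => mollify m f x) atTop (𝓝 (f x)) := by
  refine ContDiffBump.ae_convolution_tendsto_right_of_locallyIntegrable (K := 2)
    (φ := fun m => mollifier N m) ?_ ?_ hf
  · exact tendsto_one_div_add_atTop_nhds_zero_nat
  · refine Eventually.of_forall fun m => ?_
    simp only [mollifier]
    have : (0 : ℝ) < (m : ℝ) + 1 := by positivity
    field_simp
    rfl

lemma integrable_mollify (m : ℕ) {f : EuclideanSpace ℝ (Fin N) → ℝ} (hf : Integrable f) :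
    Integrable (mollify m f) :=
  (mollifier N m).integrable_normed.integrable_convolution _ hf

lemma integral_norm_mollify_le (m : ℕ) {f : EuclideanSpace ℝ (Fin N) → ℝ} (hf : Integrable f) :
    ∫ x, ‖mollify m f x‖ ≤ ∫ x, ‖f x‖ := by
  calc ∫ x, ‖mollify m f x‖ ≤ ∫ x, mollify m (fun y => ‖f y‖) x := by
        refine integral_mono (integrable_mollify m hf).norm (integrable_mollify m hf.norm) ?_
        intro x
        simp only [mollify_apply]
        refine (norm_integral_le_integral_norm _).trans_eq ?_
        congr with t
        rw [norm_mul, Real.norm_of_nonneg ((mollifier N m).nonneg_normed t)]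
    _ = ∫ x, ‖f x‖ := by
        rw [mollify, integral_convolution _ (mollifier N m).integrable_normed hf.norm]
        simp [(mollifier N m).integral_normed]

/-- Almost everywhere convergence together with non-increase of the `L¹` norm gives
convergence in `L¹`. This is the Brezis–Lieb argument: `|fₘ - f| - |fₘ| + |f|` tends to zero and
is dominated by `2 |f|`. -/
lemma tendsto_integral_norm_sub_of_ae_of_le {α : Type*} [MeasurableSpace α] {ν : Measure α}
    {F : ℕ → α → ℝ} {f : α → ℝ} (hF : ∀ m, Integrable (F m) ν) (hf : Integrable f ν)
    (hlim : ∀ᵐ x ∂ν, Tendsto (fun m => F m x) atTop (𝓝 (f x)))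
    (hle : ∀ m, ∫ x, ‖F m x‖ ∂ν ≤ ∫ x, ‖f x‖ ∂ν) :
    Tendsto (fun m => ∫ x, ‖F m x - f x‖ ∂ν) atTop (𝓝 0) := by
  have key : Tendsto (fun m => ∫ x, (‖F m x - f x‖ - ‖F m x‖ + ‖f x‖) ∂ν) atTop
      (𝓝 (∫ x, (0 : ℝ) ∂ν)) := by
    refine tendsto_integral_of_dominated_convergence (fun x => 2 * ‖f x‖)
      (fun m => (((hF m).sub hf).norm.sub (hF m).norm |>.add hf.norm).aestronglyMeasurable)
      (hf.norm.const_mul 2) (fun m => Eventually.of_forall fun x => ?_) ?_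
    · rw [Real.norm_eq_abs, abs_le]
      have h1 := norm_sub_le (F m x) (f x)
      have h2 := norm_sub_norm_le (F m x) (f x)
      constructor <;> linarith [norm_nonneg (f x)]
    · filter_upwards [hlim] with x hx
      have := ((hx.sub_const (f x)).norm.sub hx.norm).add_const ‖f x‖
      simpa using this
  rw [integral_zero] at key
  refine squeeze_zero (fun m => integral_nonneg fun x => norm_nonneg _) (fun m => ?_) key
  have h1 : Integrable (fun x => ‖F m x - f x‖) ν := ((hF m).sub hf).norm
  have h2 : ∫ x, (‖F m x - f x‖ - ‖F m x‖ + ‖f x‖) ∂ν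
      = ∫ x, (‖F m x - f x‖ - ‖F m x‖) ∂ν + ∫ x, ‖f x‖ ∂ν :=
    integral_add (h1.sub (hF m).norm) hf.norm
  rw [h2, integral_sub h1 (hF m).norm]
  linarith [hle m]

/-- Mollification is local: on a ball it only sees the function on the ball of radius larger by
`1`. -/
lemma mollify_congr_on_ball {f f' : EuclideanSpace ℝ (Fin N) → ℝ} {R : ℝ}
    (h : ∀ y, ‖y‖ ≤ R + 1 → f y = f' y) (m : ℕ) {x : EuclideanSpace ℝ (Fin N)}
    (hx : ‖x‖ ≤ R) : mollify m f x = mollify m f' x := by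
  simp only [mollify_apply]
  congr with t
  by_cases ht : (mollifier N m).normed volume t = 0
  · simp [ht]
  · have ht' : t ∈ Metric.ball (0 : EuclideanSpace ℝ (Fin N)) (mollifier N m).rOut := by
      rw [← (mollifier N m).support_normed_eq (μ := volume)]; exact ht
    have h1 : ‖t‖ < 1 / ((m : ℝ) + 1) := by simpa [mollifier] using ht'
    have h2 : 1 / ((m : ℝ) + 1) ≤ 1 := by
      rw [div_le_one (by positivity)]; linarith [(Nat.cast_nonneg m : (0 : ℝ) ≤ m)]
    rw [h]
    linarith [norm_sub_le x t]

/-- Mollifications of a locally integrable function converge in `L¹` on balls. -/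
lemma tendsto_setIntegral_norm_mollify_sub {f : EuclideanSpace ℝ (Fin N) → ℝ}
    (hf : LocallyIntegrable f) (R : ℝ) :
    Tendsto (fun m => ∫ x in Metric.closedBall 0 R, ‖mollify m f x - f x‖) atTop (𝓝 0) := by
  -- Cutting `f` off outside a larger ball makes it integrable without changing the mollification.
  set f' := (Metric.closedBall (0 : EuclideanSpace ℝ (Fin N)) (R + 1)).indicator f with hf'
  have hi : Integrable f' :=
    (hf.integrableOn_isCompact (isCompact_closedBall _ _)).integrable_indicator
      Metric.isClosed_closedBall.measurableSet
  have h0 := tendsto_integral_norm_sub_of_ae_of_le (fun m => integrable_mollify m hi) hi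
    (ae_tendsto_mollify hi.locallyIntegrable) (fun m => integral_norm_mollify_le m hi)
  have hff : ∀ y, ‖y‖ ≤ R + 1 → f y = f' y := fun y hy => by
    rw [hf', Set.indicator_of_mem]; simpa using hy
  refine squeeze_zero (fun m => integral_nonneg fun x => norm_nonneg _) (fun m => ?_) h0
  calc ∫ x in Metric.closedBall 0 R, ‖mollify m f x - f x‖
      = ∫ x in Metric.closedBall 0 R, ‖mollify m f' x - f' x‖ := by
        refine setIntegral_congr_fun Metric.isClosed_closedBall.measurableSet fun x hx => ?_
        have hx' : ‖x‖ ≤ R := by simpa using hx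
        rw [mollify_congr_on_ball hff m hx', hff x (by linarith)]
    _ ≤ _ := setIntegral_le_integral ((integrable_mollify m hi).sub hi).norm
        (Eventually.of_forall fun x => norm_nonneg _)

/-- Mollification turns weak partial derivatives into classical ones. -/
lemma fderiv_mollify {u : EuclideanSpace ℝ (Fin N) → ℝ}
    {g : EuclideanSpace ℝ (Fin N) → EuclideanSpace ℝ (Fin N)} (h : HasWeakGradient u g)
    (m : ℕ) (i : Fin N) (x : EuclideanSpace ℝ (Fin N)) :
    fderiv ℝ (mollify m u) x (EuclideanSpace.single i 1) = mollify m (fun y => g y i) x := by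
  set ρ := (mollifier N m).normed (volume : Measure (EuclideanSpace ℝ (Fin N))) with hρ
  have hρs : ContDiff ℝ ∞ ρ := (mollifier N m).contDiff_normed
  have hρc : HasCompactSupport ρ := (mollifier N m).hasCompactSupport_normed
  have hder : HasFDerivAt (mollify m u) _ x :=
    hρc.hasFDerivAt_convolution_left (ContinuousLinearMap.lsmul ℝ ℝ)
      (hρs.of_le (by simp)) h.1 x
  have hex : ConvolutionExistsAt (fderiv ℝ ρ) u x
      ((ContinuousLinearMap.lsmul ℝ ℝ).precompL (EuclideanSpace ℝ (Fin N))) volume :=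
    (hρc.fderiv (𝕜 := ℝ)).convolutionExists_left _ (hρs.continuous_fderiv (by simp)) h.1 x
  rw [hder.fderiv, convolution_def, ContinuousLinearMap.integral_apply hex]
  -- The translated and reflected mollifier serves as the test function.
  have hψs : ContDiff ℝ ∞ (fun t => ρ (x - t)) := hρs.comp (contDiff_const.sub contDiff_id)
  have hψc : HasCompactSupport (fun t => ρ (x - t)) :=
    hρc.comp_homeomorph (Homeomorph.subLeft x)
  have hψd : ∀ t v, fderiv ℝ (fun t => ρ (x - t)) t v = - fderiv ℝ ρ (x - t) v := by
    intro t v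
    have h1 : HasFDerivAt (fun t => x - t)
        (-ContinuousLinearMap.id ℝ (EuclideanSpace ℝ (Fin N))) t :=
      (hasFDerivAt_id t).const_sub x
    have h2 := ((hρs.differentiable (by simp)) (x - t)).hasFDerivAt.comp t h1
    rw [show (fun t => ρ (x - t)) = ρ ∘ (fun t => x - t) from rfl, h2.fderiv]
    simp
  have hw := h.2.2 _ hψs hψc i
  simp only [hψd, mul_neg, integral_neg, neg_inj] at hw
  rw [mollify_apply_swap, ← integral_sub_left_eq_self _ volume x]
  simp only [sub_sub_cancel]
  refine (Eq.trans ?_ hw).trans ?_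
  · congr with t
    simp [ContinuousLinearMap.precompL_apply, mul_comm]
  · congr with t
    rw [mul_comm]

/-! ### Calculus for weak gradients -/

/-- Passage to the limit in an integral of a product, one factor converging boundedly almost
everywhere and the other in `L¹`. -/
lemma tendsto_integral_mul_of_bounded {α : Type*} [MeasurableSpace α] {ν : Measure α}
    {b : ℕ → α → ℝ} {b' : α → ℝ} {F : ℕ → α → ℝ} {f : α → ℝ} {B : ℝ}
    (hbm : ∀ m, AEStronglyMeasurable (b m) ν) (hb : ∀ m x, ‖b m x‖ ≤ B)
    (hlim : ∀ᵐ x ∂ν, Tendsto (fun m => b m x) atTop (𝓝 (b' x)))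
    (hF : ∀ m, Integrable (F m) ν) (hf : Integrable f ν)
    (hFf : Tendsto (fun m => ∫ x, ‖F m x - f x‖ ∂ν) atTop (𝓝 0)) :
    Tendsto (fun m => ∫ x, b m x * F m x ∂ν) atTop (𝓝 (∫ x, b' x * f x ∂ν)) := by
  have h1 : Tendsto (fun m => ∫ x, b m x * f x ∂ν) atTop (𝓝 (∫ x, b' x * f x ∂ν)) := by
    refine tendsto_integral_of_dominated_convergence (fun x => B * ‖f x‖)
      (fun m => (hbm m).mul hf.aestronglyMeasurable) (hf.norm.const_mul B)
      (fun m => Eventually.of_forall fun x => ?_) ?_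
    · rw [norm_mul]; exact mul_le_mul_of_nonneg_right (hb m x) (norm_nonneg _)
    · filter_upwards [hlim] with x hx using hx.mul_const _
  have h2 : Tendsto (fun m => ∫ x, b m x * (F m x - f x) ∂ν) atTop (𝓝 0) := by
    refine squeeze_zero_norm (fun m => ?_) (by simpa using hFf.const_mul B)
    rw [← integral_const_mul]
    refine norm_integral_le_of_norm_le (((hF m).sub hf).norm.const_mul B)
      (Eventually.of_forall fun x => ?_)
    rw [norm_mul]; exact mul_le_mul_of_nonneg_right (hb m x) (norm_nonneg _)
  have h3 := h2.add h1
  rw [zero_add] at h3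
  refine h3.congr fun m => ?_
  rw [← integral_add]
  · congr with x; ring
  · exact ((hF m).sub hf).bdd_mul (hbm m) (Eventually.of_forall (hb m))
  · exact hf.bdd_mul (hbm m) (Eventually.of_forall (hb m))

/-- `A` is a bounded `C¹` function with bounded derivative `A'`. -/
structure BoundedC1 (A A' : ℝ → ℝ) : Prop where
  hasDerivAt : ∀ t, HasDerivAt A (A' t) t
  continuous_deriv : Continuous A'
  bound : ∃ c, ∀ t, ‖A t‖ ≤ c
  bound_deriv : ∃ c, ∀ t, ‖A' t‖ ≤ c

lemma BoundedC1.continuous {A A' : ℝ → ℝ} (h : BoundedC1 A A') : Continuous A :=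
  continuous_iff_continuousAt.2 fun t => (h.hasDerivAt t).continuousAt

lemma boundedC1_one : BoundedC1 (fun _ => 1) (fun _ => 0) :=
  ⟨fun t => hasDerivAt_const t 1, continuous_const, ⟨1, by simp⟩, ⟨0, by simp⟩⟩

lemma locallyIntegrable_apply {g : EuclideanSpace ℝ (Fin N) → EuclideanSpace ℝ (Fin N)}
    (hg : LocallyIntegrable g) (i : Fin N) : LocallyIntegrable (fun x => g x i) := by
  intro x
  obtain ⟨s, hs, hi⟩ := hg x
  exact ⟨s, hs, (EuclideanSpace.proj (𝕜 := ℝ) i).integrable_comp hi⟩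

lemma integral_eq_setIntegral_of_mul {ψ f : EuclideanSpace ℝ (Fin N) → ℝ} {R : ℝ}
    (hR : ∀ x, R < ‖x‖ → ψ x = 0) :
    ∫ x, f x * ψ x = ∫ x in Metric.closedBall 0 R, f x * ψ x := by
  refine (setIntegral_eq_integral_of_forall_compl_eq_zero fun x hx => ?_).symm
  rw [hR x (by simpa using hx), mul_zero]

lemma exists_forall_lt_norm_eq_zero {ψ : EuclideanSpace ℝ (Fin N) → ℝ}
    (hc : HasCompactSupport ψ) : ∃ R : ℝ, ∀ x, R < ‖x‖ → ψ x = 0 := by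
  obtain ⟨R, hR⟩ := hc.isCompact.isBounded.subset_closedBall 0
  refine ⟨R, fun x hx => image_eq_zero_of_notMem_tsupport fun h => ?_⟩
  have := hR h
  simp at this
  linarith

/-- Product and chain rule: bounded `C¹` functions of two weakly differentiable functions multiply
to a weakly differentiable function. The proof passes to the limit in the classical integration by
parts formula for the mollifications. -/
lemma integral_comp_mul_comp_mul_fderiv {A A' B B' : ℝ → ℝ} (hA : BoundedC1 A A')
    (hB : BoundedC1 B B') {u w : EuclideanSpace ℝ (Fin N) → ℝ}
    {g k : EuclideanSpace ℝ (Fin N) → EuclideanSpace ℝ (Fin N)}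
    (hu : HasWeakGradient u g) (hw : HasWeakGradient w k)
    {ψ : EuclideanSpace ℝ (Fin N) → ℝ} (hψ : ContDiff ℝ ∞ ψ) (hc : HasCompactSupport ψ)
    (i : Fin N) :
    ∫ x, A (u x) * B (w x) * fderiv ℝ ψ x (EuclideanSpace.single i 1)
      = - ((∫ x, A' (u x) * B (w x) * g x i * ψ x)
        + ∫ x, A (u x) * B' (w x) * k x i * ψ x) := by
  set e : EuclideanSpace ℝ (Fin N) := EuclideanSpace.single i 1
  obtain ⟨cA, hcA⟩ := hA.bound
  obtain ⟨cA', hcA'⟩ := hA.bound_deriv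
  obtain ⟨cB, hcB⟩ := hB.bound
  obtain ⟨cB', hcB'⟩ := hB.bound_deriv
  have hcA0 : 0 ≤ cA := (norm_nonneg _).trans (hcA 0)
  obtain ⟨R, hR⟩ := exists_forall_lt_norm_eq_zero hc
  obtain ⟨cψ, hcψ⟩ := hψ.continuous.bounded_above_of_compact_support hc
  have hum := fun m => contDiff_mollify m hu.1
  have hwm := fun m => contDiff_mollify m hw.1
  have hgi := locallyIntegrable_apply hu.2.1 i
  have hki := locallyIntegrable_apply hw.2.1 i
  have hψd : Continuous (fun x => fderiv ℝ ψ x e) :=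
    (hψ.continuous_fderiv (by simp)).clm_apply continuous_const
  have hψdc : HasCompactSupport (fun x => fderiv ℝ ψ x e) := hc.fderiv_apply (𝕜 := ℝ) e
  have hd : ∀ m x, HasFDerivAt (fun y => A (mollify m u y) * B (mollify m w y))
      (A (mollify m u x) • (B' (mollify m w x) • fderiv ℝ (mollify m w) x)
        + B (mollify m w x) • (A' (mollify m u x) • fderiv ℝ (mollify m u) x)) x := by
    intro m x
    exact ((hA.hasDerivAt _).comp_hasFDerivAt x
      ((hum m).differentiable (by simp) x).hasFDerivAt).mul
      ((hB.hasDerivAt _).comp_hasFDerivAt x ((hwm m).differentiable (by simp) x).hasFDerivAt)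
  have hcu : ∀ m, Continuous (mollify m u) := fun m => (hum m).continuous
  have hcw : ∀ m, Continuous (mollify m w) := fun m => (hwm m).continuous
  have hcg : ∀ m, Continuous (mollify m (fun y => g y i)) := fun m =>
    (contDiff_mollify m hgi).continuous
  have hck : ∀ m, Continuous (mollify m (fun y => k y i)) := fun m =>
    (contDiff_mollify m hki).continuous
  have hA1 := hA.continuous
  have hB1 := hB.continuous
  have hA2 := hA.continuous_deriv
  have hB2 := hB.continuous_deriv
  have hi1 : ∀ m, Integrable (fun x => A' (mollify m u x) * B (mollify m w x)
      * mollify m (fun y => g y i) x * ψ x) := fun m =>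
    Continuous.integrable_of_hasCompactSupport (by fun_prop) hc.mul_left
  have hi2 : ∀ m, Integrable (fun x => A (mollify m u x) * B' (mollify m w x)
      * mollify m (fun y => k y i) x * ψ x) := fun m =>
    Continuous.integrable_of_hasCompactSupport (by fun_prop) hc.mul_left
  have hfd : ∀ m x, fderiv ℝ (fun y => A (mollify m u y) * B (mollify m w y)) x e * ψ x
      = A' (mollify m u x) * B (mollify m w x) * mollify m (fun y => g y i) x * ψ x
      + A (mollify m u x) * B' (mollify m w x) * mollify m (fun y => k y i) x * ψ x := by
    intro m x
    rw [(hd m x).fderiv]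
    simp only [add_apply, smul_apply, smul_eq_mul, e,
      fderiv_mollify hu, fderiv_mollify hw]
    ring
  have hparts : ∀ m, ∫ x, A (mollify m u x) * B (mollify m w x) * fderiv ℝ ψ x e
      = - ((∫ x, A' (mollify m u x) * B (mollify m w x) * mollify m (fun y => g y i) x * ψ x)
        + ∫ x, A (mollify m u x) * B' (mollify m w x) * mollify m (fun y => k y i) x * ψ x) := by
    intro m
    rw [← integral_add (hi1 m) (hi2 m)]
    simp only [← hfd]
    refine integral_mul_fderiv_eq_neg_fderiv_mul_of_integrable ?_ ?_ ?_
      (fun x _ => (hd m x).differentiableAt) (fun x _ => hψ.differentiable (by simp) x)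
    · simp only [hfd]; exact (hi1 m).add (hi2 m)
    · exact Continuous.integrable_of_hasCompactSupport (by fun_prop) hψdc.mul_left
    · have := hψ.continuous
      exact Continuous.integrable_of_hasCompactSupport (by fun_prop) hc.mul_left
  have hlu := ae_tendsto_mollify hu.1
  have hlw := ae_tendsto_mollify hw.1
  have hL : Tendsto (fun m => ∫ x, A (mollify m u x) * B (mollify m w x) * fderiv ℝ ψ x e) atTop
      (𝓝 (∫ x, A (u x) * B (w x) * fderiv ℝ ψ x e)) := by
    have hint : Integrable (fun x => fderiv ℝ ψ x e) := hψd.integrable_of_hasCompactSupport hψdc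
    refine tendsto_integral_mul_of_bounded (B := cA * cB)
      (fun m => (Continuous.aestronglyMeasurable (by fun_prop))) (fun m x => ?_) ?_
      (fun m => hint) hint (by simp)
    · rw [norm_mul]
      exact mul_le_mul (hcA _) (hcB _) (norm_nonneg _) hcA0
    · filter_upwards [hlu, hlw] with x h1 h2
      exact ((hA1.tendsto _).comp h1).mul ((hB1.tendsto _).comp h2)
  have hgen : ∀ {P Q : ℝ → ℝ} {cP cQ : ℝ} (_ : Continuous P) (_ : Continuous Q)
      (_ : ∀ t, ‖P t‖ ≤ cP) (_ : ∀ t, ‖Q t‖ ≤ cQ) {f : EuclideanSpace ℝ (Fin N) → ℝ}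
      (_ : LocallyIntegrable f),
      Tendsto (fun m => ∫ x, P (mollify m u x) * Q (mollify m w x) * mollify m f x * ψ x) atTop
        (𝓝 (∫ x, P (u x) * Q (w x) * f x * ψ x)) := by
    intro P Q cP cQ hP hQ hcP hcQ f hf
    have hcP0 : 0 ≤ cP := (norm_nonneg _).trans (hcP 0)
    have hcQ0 : 0 ≤ cQ := (norm_nonneg _).trans (hcQ 0)
    simp only [integral_eq_setIntegral_of_mul hR]
    have hψ0 := hψ.continuous
    have := tendsto_integral_mul_of_bounded
      (ν := volume.restrict (Metric.closedBall (0 : EuclideanSpace ℝ (Fin N)) R))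
      (B := cP * cQ * cψ)
      (b := fun m x => P (mollify m u x) * Q (mollify m w x) * ψ x)
      (b' := fun x => P (u x) * Q (w x) * ψ x) (F := fun m => mollify m f) (f := f)
      (fun m => (Continuous.aestronglyMeasurable (by fun_prop))) (fun m x => ?_) ?_
      (fun m => (contDiff_mollify m hf).continuous.locallyIntegrable.integrableOn_isCompact
        (isCompact_closedBall _ _))
      (hf.integrableOn_isCompact (isCompact_closedBall _ _))
      (tendsto_setIntegral_norm_mollify_sub hf R)
    · simpa only [mul_right_comm] using this
    · rw [norm_mul, norm_mul]
      exact mul_le_mul (mul_le_mul (hcP _) (hcQ _) (norm_nonneg _) hcP0) (hcψ x)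
        (norm_nonneg _) (by positivity)
    · refine ae_restrict_of_ae ?_
      filter_upwards [hlu, hlw] with x h1 h2
      exact (((hP.tendsto _).comp h1).mul ((hQ.tendsto _).comp h2)).mul_const _
  refine tendsto_nhds_unique hL ?_
  simp only [hparts]
  exact ((hgen hA2 hB1 hcA' hcB hgi).add (hgen hA1 hB2 hcA hcB' hki)).neg

/-! ### Truncation -/

/-- A smooth truncation at level `c`: a bounded rational function of slope at most `1`
with `|trunc c t| ≤ |t|` and `trunc c t → t` as `c → ∞`. -/
noncomputable def trunc (c t : ℝ) : ℝ := t * c / (c + t ^ 2)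

/-- The derivative of `trunc c`. -/
noncomputable def truncDeriv (c t : ℝ) : ℝ := c * (c - t ^ 2) / (c + t ^ 2) ^ 2

lemma hasDerivAt_trunc {c : ℝ} (hc : 1 ≤ c) (t : ℝ) :
    HasDerivAt (trunc c) (truncDeriv c t) t := by
  have h0 : c + t ^ 2 ≠ 0 := by positivity
  have h := ((hasDerivAt_id t).mul_const c).div ((hasDerivAt_pow 2 t).const_add c) h0
  have h1 : truncDeriv c t
      = (1 * c * (c + t ^ 2) - id t * c * (((2 : ℕ) : ℝ) * t ^ (2 - 1))) / (c + t ^ 2) ^ 2 := by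
    simp only [truncDeriv, id]
    congr 1
    push_cast
    ring
  rw [h1]
  exact h

lemma abs_trunc_le {c : ℝ} (hc : 1 ≤ c) (t : ℝ) : |trunc c t| ≤ |t| := by
  have h0 : 0 < c + t ^ 2 := by positivity
  rw [trunc, abs_div, abs_mul, abs_of_pos h0, abs_of_pos (by linarith : 0 < c), div_le_iff₀ h0]
  exact mul_le_mul_of_nonneg_left (by nlinarith) (abs_nonneg t)

lemma abs_trunc_le_level {c : ℝ} (hc : 1 ≤ c) (t : ℝ) : |trunc c t| ≤ c := by
  have h0 : 0 < c + t ^ 2 := by positivity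
  rw [trunc, abs_div, abs_mul, abs_of_pos h0, abs_of_pos (by linarith : 0 < c), div_le_iff₀ h0,
    mul_comm, ← sq_abs t]
  exact mul_le_mul_of_nonneg_left (by nlinarith [sq_nonneg (|t| - 1)]) (by linarith)

lemma abs_truncDeriv_le {c : ℝ} (hc : 1 ≤ c) (t : ℝ) : |truncDeriv c t| ≤ 1 := by
  have h0 : 0 < c + t ^ 2 := by positivity
  rw [truncDeriv, abs_div, abs_of_pos (by positivity : 0 < (c + t ^ 2) ^ 2),
    div_le_one (by positivity), abs_le]
  constructor <;> nlinarith [sq_nonneg t, sq_nonneg (t ^ 2)]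

lemma continuous_truncDeriv {c : ℝ} (hc : 1 ≤ c) : Continuous (truncDeriv c) := by
  unfold truncDeriv
  refine Continuous.div (by fun_prop) (by fun_prop) fun t => ?_
  positivity

lemma tendsto_trunc (t : ℝ) :
    Tendsto (fun m : ℕ => trunc ((m : ℝ) + 1) t) atTop (𝓝 t) := by
  have h1 : Tendsto (fun m : ℕ => (1 : ℝ) / ((m : ℝ) + 1)) atTop (𝓝 0) :=
    tendsto_one_div_add_atTop_nhds_zero_nat
  have h2 := (tendsto_const_nhds (x := t)).div ((h1.mul_const (t ^ 2)).const_add 1) (by simp)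
  simp only [zero_mul, add_zero, div_one] at h2
  refine h2.congr fun m => ?_
  have : (0 : ℝ) < (m : ℝ) + 1 := by positivity
  have h3 : (m : ℝ) + 1 + t ^ 2 ≠ 0 := by positivity
  simp only [trunc, Pi.div_apply]
  field_simp

lemma tendsto_truncDeriv (t : ℝ) :
    Tendsto (fun m : ℕ => truncDeriv ((m : ℝ) + 1) t) atTop (𝓝 1) := by
  have h1 : Tendsto (fun m : ℕ => (1 : ℝ) / ((m : ℝ) + 1)) atTop (𝓝 0) :=
    tendsto_one_div_add_atTop_nhds_zero_nat
  have h2 := ((h1.mul_const (t ^ 2)).const_sub 1).div (((h1.mul_const (t ^ 2)).const_add 1).pow 2)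
    (by simp)
  simp only [zero_mul, add_zero, sub_zero, one_pow, div_one] at h2
  refine h2.congr fun m => ?_
  have : (0 : ℝ) < (m : ℝ) + 1 := by positivity
  have h3 : (m : ℝ) + 1 + t ^ 2 ≠ 0 := by positivity
  simp only [truncDeriv, Pi.div_apply]
  field_simp

lemma boundedC1_trunc_sq {c : ℝ} (hc : 1 ≤ c) :
    BoundedC1 (fun t => trunc c t ^ 2) (fun t => 2 * trunc c t * truncDeriv c t) := by
  have hcont : Continuous (trunc c) :=
    continuous_iff_continuousAt.2 fun t => (hasDerivAt_trunc hc t).continuousAt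
  refine ⟨fun t => ?_, (hcont.const_mul 2).mul (continuous_truncDeriv hc),
    ⟨c ^ 2, fun t => ?_⟩, ⟨2 * c, fun t => ?_⟩⟩
  · have h := (hasDerivAt_trunc hc t).pow 2
    simp only [Nat.cast_ofNat, Nat.add_one_sub_one, pow_one] at h
    exact h
  · rw [norm_pow, Real.norm_eq_abs]
    exact pow_le_pow_left₀ (abs_nonneg _) (abs_trunc_le_level hc t) 2
  · rw [norm_mul, norm_mul, Real.norm_eq_abs, Real.norm_eq_abs, Real.norm_eq_abs, abs_two]
    have := mul_le_mul (abs_trunc_le_level hc t) (abs_truncDeriv_le hc t) (abs_nonneg _)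
      (by linarith)
    linarith

/-! ### Weak gradients of weighted functions -/

lemma integrable_mul_of_locallyIntegrable
    {f ψ : EuclideanSpace ℝ (Fin N) → ℝ} (hf : LocallyIntegrable f) (hψ : Continuous ψ)
    (hc : HasCompactSupport ψ) : Integrable (fun x => f x * ψ x) := by
  have := hf.integrable_smul_right_of_hasCompactSupport hψ hc
  simpa using this

/-- For a bounded `C¹` function `A`, a weakly differentiable `u` and a weight `w ^ 2`, the product
`A(u) w²` is weakly differentiable and satisfies the Leibniz rule. The weight itself is unbounded;
it is approximated by `trunc c w ^ 2`. -/
lemma integral_comp_mul_sq_mul_fderiv {A A' : ℝ → ℝ} (hA : BoundedC1 A A')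
    {u w : EuclideanSpace ℝ (Fin N) → ℝ}
    {g k : EuclideanSpace ℝ (Fin N) → EuclideanSpace ℝ (Fin N)}
    (hu : HasWeakGradient u g) (hw : HasWeakGradient w k)
    (hw2 : LocallyIntegrable (fun x => w x ^ 2)) (hwk : LocallyIntegrable (fun x => w x • k x))
    (hwg : LocallyIntegrable (fun x => w x ^ 2 • g x))
    {ψ : EuclideanSpace ℝ (Fin N) → ℝ} (hψ : ContDiff ℝ ∞ ψ) (hc : HasCompactSupport ψ)
    (i : Fin N) :
    ∫ x, A (u x) * w x ^ 2 * fderiv ℝ ψ x (EuclideanSpace.single i 1)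
      = - ((∫ x, A' (u x) * w x ^ 2 * g x i * ψ x)
        + ∫ x, A (u x) * (2 * w x * k x i) * ψ x) := by
  set e : EuclideanSpace ℝ (Fin N) := EuclideanSpace.single i 1
  obtain ⟨cA, hcA⟩ := hA.bound
  obtain ⟨cA', hcA'⟩ := hA.bound_deriv
  have hcA0 : 0 ≤ cA := (norm_nonneg _).trans (hcA 0)
  have hcA'0 : 0 ≤ cA' := (norm_nonneg _).trans (hcA' 0)
  have hlevel : ∀ m : ℕ, (1 : ℝ) ≤ (m : ℝ) + 1 := fun m => by
    linarith [(Nat.cast_nonneg m : (0 : ℝ) ≤ m)]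
  have hψd : Continuous (fun x => fderiv ℝ ψ x e) :=
    (hψ.continuous_fderiv (by simp)).clm_apply continuous_const
  have hψdc : HasCompactSupport (fun x => fderiv ℝ ψ x e) := hc.fderiv_apply (𝕜 := ℝ) e
  have hum := hu.1.aestronglyMeasurable
  have hwm := hw.1.aestronglyMeasurable
  have hAu : AEStronglyMeasurable (fun x => A (u x)) :=
    hA.continuous.comp_aestronglyMeasurable hum
  have hA'u : AEStronglyMeasurable (fun x => A' (u x)) :=
    hA.continuous_deriv.comp_aestronglyMeasurable hum
  have hBw : ∀ m : ℕ, AEStronglyMeasurable (fun x => trunc ((m : ℝ) + 1) (w x) ^ 2) := fun m =>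
    (boundedC1_trunc_sq (hlevel m)).continuous.comp_aestronglyMeasurable hwm
  have hB'w : ∀ m : ℕ, AEStronglyMeasurable
      (fun x => 2 * trunc ((m : ℝ) + 1) (w x) * truncDeriv ((m : ℝ) + 1) (w x)) := fun m =>
    (boundedC1_trunc_sq (hlevel m)).continuous_deriv.comp_aestronglyMeasurable hwm
  have hgi := (locallyIntegrable_apply hu.2.1 i).aestronglyMeasurable
  have hki := (locallyIntegrable_apply hw.2.1 i).aestronglyMeasurable
  have hψm := hψ.continuous.aestronglyMeasurable (μ := (volume : Measure
    (EuclideanSpace ℝ (Fin N))))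
  have hψdm := hψd.aestronglyMeasurable (μ := (volume : Measure (EuclideanSpace ℝ (Fin N))))
  have hB_le : ∀ (m : ℕ) x, ‖trunc ((m : ℝ) + 1) (w x) ^ 2‖ ≤ ‖w x ^ 2‖ := fun m x => by
    rw [norm_pow, norm_pow, Real.norm_eq_abs, Real.norm_eq_abs]
    exact pow_le_pow_left₀ (abs_nonneg _) (abs_trunc_le (hlevel m) _) 2
  have hB'_le : ∀ (m : ℕ) x,
      ‖2 * trunc ((m : ℝ) + 1) (w x) * truncDeriv ((m : ℝ) + 1) (w x)‖ ≤ 2 * ‖w x‖ := fun m x => by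
    rw [norm_mul, norm_mul, Real.norm_eq_abs, Real.norm_eq_abs, Real.norm_eq_abs, abs_two]
    have := mul_le_mul (abs_trunc_le (hlevel m) (w x)) (abs_truncDeriv_le (hlevel m) (w x))
      (abs_nonneg _) (abs_nonneg _)
    rw [Real.norm_eq_abs]
    linarith
  have hlim1 : Tendsto (fun m : ℕ => ∫ x, A (u x) * trunc ((m : ℝ) + 1) (w x) ^ 2 *
      fderiv ℝ ψ x e) atTop (𝓝 (∫ x, A (u x) * w x ^ 2 * fderiv ℝ ψ x e)) := by
    refine tendsto_integral_of_dominated_convergence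
      (fun x => cA * ‖w x ^ 2 * fderiv ℝ ψ x e‖) (fun m => (hAu.mul (hBw m)).mul hψdm)
      ((integrable_mul_of_locallyIntegrable hw2 hψd hψdc).norm.const_mul cA)
      (fun m => Eventually.of_forall fun x => ?_) (Eventually.of_forall fun x => ?_)
    · rw [mul_assoc, norm_mul, norm_mul, norm_mul]
      gcongr
      · exact hcA _
      · exact hB_le m x
    · exact (((tendsto_trunc (w x)).pow 2).const_mul _).mul_const _
  have hlim2 : Tendsto (fun m : ℕ => ∫ x, A' (u x) * trunc ((m : ℝ) + 1) (w x) ^ 2 * g x i * ψ x)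
      atTop (𝓝 (∫ x, A' (u x) * w x ^ 2 * g x i * ψ x)) := by
    refine tendsto_integral_of_dominated_convergence
      (fun x => cA' * ‖w x ^ 2 * g x i * ψ x‖)
      (fun m => ((hA'u.mul (hBw m)).mul hgi).mul hψm)
      ((integrable_mul_of_locallyIntegrable
        (by simpa using locallyIntegrable_apply hwg i) hψ.continuous hc).norm.const_mul cA')
      (fun m => Eventually.of_forall fun x => ?_) (Eventually.of_forall fun x => ?_)
    · rw [mul_assoc, mul_assoc, norm_mul, norm_mul, mul_assoc, norm_mul (w x ^ 2)]
      gcongr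
      · exact hcA' _
      · exact hB_le m x
    · exact ((((tendsto_trunc (w x)).pow 2).const_mul _).mul_const _).mul_const _
  have hlim3 : Tendsto (fun m : ℕ => ∫ x, A (u x) *
      (2 * trunc ((m : ℝ) + 1) (w x) * truncDeriv ((m : ℝ) + 1) (w x)) * k x i * ψ x)
      atTop (𝓝 (∫ x, A (u x) * (2 * w x * k x i) * ψ x)) := by
    refine tendsto_integral_of_dominated_convergence
      (fun x => cA * 2 * ‖w x * k x i * ψ x‖)
      (fun m => ((hAu.mul (hB'w m)).mul hki).mul hψm)
      ((integrable_mul_of_locallyIntegrable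
        (by simpa using locallyIntegrable_apply hwk i) hψ.continuous hc).norm.const_mul _)
      (fun m => Eventually.of_forall fun x => ?_) (Eventually.of_forall fun x => ?_)
    · calc _ = ‖A (u x)‖ * ‖2 * trunc ((m : ℝ) + 1) (w x) * truncDeriv ((m : ℝ) + 1) (w x)‖ *
            ‖k x i * ψ x‖ := by
              rw [mul_assoc, norm_mul, norm_mul]
        _ ≤ cA * (2 * ‖w x‖) * ‖k x i * ψ x‖ := by
          gcongr
          · exact hcA _
          · exact hB'_le m x
        _ = _ := by rw [mul_assoc (w x), norm_mul (w x)]; ring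
    · have := ((((tendsto_trunc (w x)).const_mul 2).mul (tendsto_truncDeriv (w x))).const_mul
        (A (u x))).mul_const (k x i) |>.mul_const (ψ x)
      convert this using 2
      ring
  refine tendsto_nhds_unique hlim1 ?_
  exact (hlim2.add hlim3).neg.congr fun m => (integral_comp_mul_comp_mul_fderiv hA
    (boundedC1_trunc_sq (hlevel m)) hu hw hψ hc i).symm

lemma HasWeakGradient.congr_ae {u u' : EuclideanSpace ℝ (Fin N) → ℝ}
    {g : EuclideanSpace ℝ (Fin N) → EuclideanSpace ℝ (Fin N)} (h : HasWeakGradient u g)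
    (huu' : u =ᵐ[volume] u') : HasWeakGradient u' g := by
  refine ⟨(locallyIntegrable_congr huu').1 h.1, h.2.1, fun ψ hψ hc i => ?_⟩
  rw [← h.2.2 ψ hψ hc i]
  refine integral_congr_ae ?_
  filter_upwards [huu'] with x hx
  rw [hx]

lemma hasWeakGradient_zero :
    HasWeakGradient (0 : EuclideanSpace ℝ (Fin N) → ℝ) 0 :=
  ⟨locallyIntegrable_zero, locallyIntegrable_zero, by simp⟩

lemma hasWeakGradient_sq {w : EuclideanSpace ℝ (Fin N) → ℝ}
    {k : EuclideanSpace ℝ (Fin N) → EuclideanSpace ℝ (Fin N)} (hw : HasWeakGradient w k)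
    (hw2 : LocallyIntegrable (fun x => w x ^ 2)) (hwk : LocallyIntegrable (fun x => w x • k x)) :
    HasWeakGradient (fun x => w x ^ 2) (fun x => (2 : ℝ) • (w x • k x)) := by
  refine ⟨hw2, hwk.smul (2 : ℝ), fun ψ hψ hc i => ?_⟩
  have := integral_comp_mul_sq_mul_fderiv boundedC1_one hasWeakGradient_zero hw hw2 hwk
    (by simpa using locallyIntegrable_zero) hψ hc i
  simpa [mul_assoc] using this

/-- The weak gradient is unique almost everywhere. -/
lemma weakGrad_ae_eq {u : EuclideanSpace ℝ (Fin N) → ℝ}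
    {g : EuclideanSpace ℝ (Fin N) → EuclideanSpace ℝ (Fin N)} (h : HasWeakGradient u g) :
    weakGrad u =ᵐ[volume] g := by
  have hex : ∃ g, HasWeakGradient u g := ⟨g, h⟩
  have h' : HasWeakGradient u (weakGrad u) := by
    rw [weakGrad, dif_pos hex]; exact hex.choose_spec
  have hi : ∀ i : Fin N, ∀ᵐ x, weakGrad u x i = g x i := fun i => by
    refine ae_eq_of_integral_contDiff_smul_eq (locallyIntegrable_apply h'.2.1 i)
      (locallyIntegrable_apply h.2.1 i) fun ψ hψ hc => ?_
    have h1 := h.2.2 ψ hψ hc i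
    rw [h'.2.2 ψ hψ hc i, neg_inj] at h1
    simpa [mul_comm] using h1
  filter_upwards [ae_all_iff.2 hi] with x hx
  ext i
  exact hx i

/-! ### The multipolar vector field -/

variable {n : ℕ}

/-- The vector field `∑ⱼ (x - aⱼ) / |x - aⱼ|²`, the gradient of `∑ⱼ log |x - aⱼ|`. -/
noncomputable def poleField (a : Fin n → EuclideanSpace ℝ (Fin N))
    (x : EuclideanSpace ℝ (Fin N)) : EuclideanSpace ℝ (Fin N) :=
  ∑ j, (‖x - a j‖ ^ 2)⁻¹ • (x - a j)

/-- The sum `∑ⱼ 1 / |x - aⱼ|²`. -/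
noncomputable def poleSum (a : Fin n → EuclideanSpace ℝ (Fin N))
    (x : EuclideanSpace ℝ (Fin N)) : ℝ :=
  ∑ j, (‖x - a j‖ ^ 2)⁻¹

/-- The product `∏ⱼ |x - aⱼ|²`, which vanishes exactly at the poles. -/
noncomputable def poleProd (a : Fin n → EuclideanSpace ℝ (Fin N))
    (x : EuclideanSpace ℝ (Fin N)) : ℝ :=
  ∏ j, ‖x - a j‖ ^ 2

lemma contDiff_poleProd (a : Fin n → EuclideanSpace ℝ (Fin N)) : ContDiff ℝ ∞ (poleProd a) :=
  contDiff_prod fun _ _ => (contDiff_id.sub contDiff_const).norm_sq ℝ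

lemma poleProd_pos {a : Fin n → EuclideanSpace ℝ (Fin N)} {x : EuclideanSpace ℝ (Fin N)}
    (hx : ∀ j, x ≠ a j) : 0 < poleProd a x :=
  Finset.prod_pos fun j _ => by
    have := norm_pos_iff.2 (sub_ne_zero.2 (hx j))
    positivity

lemma poleProd_eq_zero {a : Fin n → EuclideanSpace ℝ (Fin N)} {x : EuclideanSpace ℝ (Fin N)}
    (hx : ¬ ∀ j, x ≠ a j) : poleProd a x = 0 := by
  push Not at hx
  obtain ⟨j, hj⟩ := hx
  exact Finset.prod_eq_zero (Finset.mem_univ j) (by simp [hj])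

lemma hasFDerivAt_norm_sub_sq (b x : EuclideanSpace ℝ (Fin N)) :
    HasFDerivAt (fun y => ‖y - b‖ ^ 2) (2 • innerSL ℝ (x - b)) x := by
  have h := ((hasFDerivAt_id x).sub_const b).norm_sq
  simp only [ContinuousLinearMap.comp_id, id] at h
  exact h

/-- Polarization. The restriction `i ≠ j` in `potentialV` is immaterial, as the numerator vanishes
on the diagonal. -/
lemma norm_poleField_sq {a : Fin n → EuclideanSpace ℝ (Fin N)} {x : EuclideanSpace ℝ (Fin N)}
    (hx : ∀ j, x ≠ a j) : ‖poleField a x‖ ^ 2 = n * poleSum a x - potentialV a x := by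
  have hr : ∀ j, ‖x - a j‖ ≠ 0 := fun j => norm_ne_zero_iff.2 (sub_ne_zero.2 (hx j))
  have hterm : ∀ i j, inner ℝ ((‖x - a i‖ ^ 2)⁻¹ • (x - a i)) ((‖x - a j‖ ^ 2)⁻¹ • (x - a j))
      = (1 / 2) * (‖x - a i‖ ^ 2)⁻¹ + (1 / 2) * (‖x - a j‖ ^ 2)⁻¹
        - (1 / 2) * (if i ≠ j then ‖a i - a j‖ ^ 2 / (‖x - a i‖ ^ 2 * ‖x - a j‖ ^ 2) else 0) := by
    intro i j
    have h1 : (if i ≠ j then ‖a i - a j‖ ^ 2 / (‖x - a i‖ ^ 2 * ‖x - a j‖ ^ 2) else 0)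
        = ‖a i - a j‖ ^ 2 / (‖x - a i‖ ^ 2 * ‖x - a j‖ ^ 2) := by
      split_ifs with h
      · rfl
      · push Not at h
        simp [h]
    have h2 : ‖a i - a j‖ ^ 2
        = ‖x - a j‖ ^ 2 - 2 * inner ℝ (x - a j) (x - a i) + ‖x - a i‖ ^ 2 := by
      rw [← norm_sub_sq_real]; congr 2; abel
    rw [h1, h2, real_inner_smul_left, real_inner_smul_right, real_inner_comm (x - a i)]
    have := hr i
    have := hr j
    field_simp
    ring
  rw [← real_inner_self_eq_norm_sq, poleField]
  rw [sum_inner]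
  simp only [inner_sum, hterm, Finset.sum_sub_distrib, Finset.sum_add_distrib,
    ← Finset.mul_sum, Finset.sum_const, Finset.card_univ, Fintype.card_fin, nsmul_eq_mul]
  simp only [potentialV, poleSum]
  ring

/-- Far from the poles the field is bounded, which controls the error of the cutoff at infinity. -/
lemma norm_poleField_le {a : Fin n → EuclideanSpace ℝ (Fin N)} {x : EuclideanSpace ℝ (Fin N)}
    (hx : ∀ j, 1 ≤ ‖x - a j‖) : ‖poleField a x‖ ≤ n := by
  refine (norm_sum_le _ _).trans ?_
  calc ∑ j, ‖(‖x - a j‖ ^ 2)⁻¹ • (x - a j)‖ ≤ ∑ _j : Fin n, (1 : ℝ) := by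
        refine Finset.sum_le_sum fun j _ => ?_
        have h := hx j
        rw [norm_smul, norm_inv, norm_pow, norm_norm, inv_mul_le_iff₀ (by positivity)]
        nlinarith
    _ = n := by simp

/-- `poleField` is half of the gradient of `log poleProd`. -/
lemma fderiv_poleProd_poleField {a : Fin n → EuclideanSpace ℝ (Fin N)}
    {x : EuclideanSpace ℝ (Fin N)} (hx : ∀ j, x ≠ a j) :
    fderiv ℝ (poleProd a) x (poleField a x) = 2 * poleProd a x * ‖poleField a x‖ ^ 2 := by
  have hr : ∀ j, ‖x - a j‖ ≠ 0 := fun j => norm_ne_zero_iff.2 (sub_ne_zero.2 (hx j))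
  have h : HasFDerivAt (poleProd a) _ x :=
    HasFDerivAt.finsetProd (u := Finset.univ) fun j _ => hasFDerivAt_norm_sub_sq (a j) x
  have herase : ∀ j, ∏ i ∈ Finset.univ.erase j, ‖x - a i‖ ^ 2
      = poleProd a x * (‖x - a j‖ ^ 2)⁻¹ := fun j => by
    rw [poleProd, ← Finset.mul_prod_erase _ _ (Finset.mem_univ j)]
    have := hr j
    field_simp
  rw [h.fderiv, ← real_inner_self_eq_norm_sq]
  nth_rewrite 2 [poleField]
  simp only [herase, sum_inner, sum_apply, smul_apply, innerSL_apply_apply,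
    real_inner_smul_left, Finset.mul_sum, smul_eq_mul, nsmul_eq_mul]
  refine Finset.sum_congr rfl fun j _ => ?_
  push_cast
  ring

lemma hasFDerivAt_pole_apply {b x : EuclideanSpace ℝ (Fin N)} (hx : x ≠ b) (i : Fin N) :
    HasFDerivAt (fun y : EuclideanSpace ℝ (Fin N) => (‖y - b‖ ^ 2)⁻¹ * (y - b) i)
      ((‖x - b‖ ^ 2)⁻¹ • EuclideanSpace.proj (𝕜 := ℝ) i
        + (x - b) i • (-((‖x - b‖ ^ 2) ^ 2)⁻¹ • (2 • innerSL ℝ (x - b)))) x := by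
  have hr : ‖x - b‖ ^ 2 ≠ 0 := pow_ne_zero 2 (norm_ne_zero_iff.2 (sub_ne_zero.2 hx))
  have h1 := (hasDerivAt_inv hr).comp_hasFDerivAt x (hasFDerivAt_norm_sub_sq b x)
  have h2 : HasFDerivAt (fun y : EuclideanSpace ℝ (Fin N) => (y - b) i)
      (EuclideanSpace.proj (𝕜 := ℝ) i) x := by
    have := (EuclideanSpace.proj (𝕜 := ℝ) i : EuclideanSpace ℝ (Fin N) →L[ℝ] ℝ).hasFDerivAt
      (x := x - b)
    exact this.comp x ((hasFDerivAt_id x).sub_const b)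
  exact h1.mul h2

lemma poleField_apply (a : Fin n → EuclideanSpace ℝ (Fin N)) (i : Fin N) :
    (fun x => poleField a x i) = fun x => ∑ j, (‖x - a j‖ ^ 2)⁻¹ * (x - a j) i := by
  ext x
  simp [poleField]

lemma differentiableAt_poleField_apply {a : Fin n → EuclideanSpace ℝ (Fin N)}
    {x : EuclideanSpace ℝ (Fin N)} (hx : ∀ j, x ≠ a j) (i : Fin N) :
    DifferentiableAt ℝ (fun y => poleField a y i) x := by
  rw [poleField_apply]
  exact (HasFDerivAt.fun_sum fun j _ => hasFDerivAt_pole_apply (hx j) i).differentiableAt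

/-- The divergence of the multipolar field is `(N - 2) ∑ⱼ 1 / |x - aⱼ|²` off the poles. -/
lemma sum_fderiv_poleField {a : Fin n → EuclideanSpace ℝ (Fin N)}
    {x : EuclideanSpace ℝ (Fin N)} (hx : ∀ j, x ≠ a j) :
    ∑ i, fderiv ℝ (fun y => poleField a y i) x (EuclideanSpace.single i 1)
      = ((N : ℝ) - 2) * poleSum a x := by
  have h : ∀ i, fderiv ℝ (fun y => poleField a y i) x (EuclideanSpace.single i 1)
      = ∑ j, ((‖x - a j‖ ^ 2)⁻¹ - 2 * ((‖x - a j‖ ^ 2) ^ 2)⁻¹ * (x - a j) i ^ 2) := by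
    intro i
    rw [poleField_apply,
      (HasFDerivAt.fun_sum fun j _ => hasFDerivAt_pole_apply (hx j) i).fderiv]
    simp only [sum_apply]
    refine Finset.sum_congr rfl fun j _ => ?_
    simp [EuclideanSpace.inner_single_right]
    ring
  simp only [h]
  rw [Finset.sum_comm, poleSum, Finset.mul_sum]
  refine Finset.sum_congr rfl fun j _ => ?_
  have hr : ‖x - a j‖ ≠ 0 := norm_ne_zero_iff.2 (sub_ne_zero.2 (hx j))
  rw [Finset.sum_sub_distrib, ← Finset.mul_sum]
  have h2 : ∑ i, (x - a j) i ^ 2 = ‖x - a j‖ ^ 2 := by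
    rw [EuclideanSpace.norm_sq_eq]
    simp
  rw [h2]
  simp only [Finset.sum_const, Finset.card_univ, Fintype.card_fin, nsmul_eq_mul]
  field_simp

/-! ### Cutoffs -/

/-- A smooth cutoff vanishing near the poles and tending to `1` off the poles as `m → ∞`. Being an
increasing function of `poleProd`, it increases in the direction of `poleField`. -/
noncomputable def poleCutoff (a : Fin n → EuclideanSpace ℝ (Fin N)) (m : ℕ)
    (x : EuclideanSpace ℝ (Fin N)) : ℝ :=
  Real.smoothTransition (((m : ℝ) + 1) * poleProd a x - 1)

lemma contDiff_poleCutoff (a : Fin n → EuclideanSpace ℝ (Fin N)) (m : ℕ) :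
    ContDiff ℝ ∞ (poleCutoff a m) :=
  Real.smoothTransition.contDiff.comp
    ((contDiff_const.mul (contDiff_poleProd a)).sub contDiff_const)

lemma fderiv_poleCutoff_poleField_nonneg {a : Fin n → EuclideanSpace ℝ (Fin N)} (m : ℕ)
    {x : EuclideanSpace ℝ (Fin N)} (hx : ∀ j, x ≠ a j) :
    0 ≤ fderiv ℝ (poleCutoff a m) x (poleField a x) := by
  have h1 : HasFDerivAt (fun y => ((m : ℝ) + 1) * poleProd a y - 1)
      (((m : ℝ) + 1) • fderiv ℝ (poleProd a) x) x :=
    (((contDiff_poleProd a).differentiable (by simp) x).hasFDerivAt.const_mul _).sub_const 1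
  have h2 : HasFDerivAt (poleCutoff a m) _ x :=
    ((Real.smoothTransition.contDiff (n := 1)).differentiable
      (by simp) _).hasDerivAt.comp_hasFDerivAt x h1
  rw [h2.fderiv]
  simp only [smul_apply, smul_eq_mul, fderiv_poleProd_poleField hx]
  have h3 := Real.smoothTransition.monotone.deriv_nonneg
    (x := ((m : ℝ) + 1) * poleProd a x - 1)
  have h4 := (poleProd_pos hx).le
  positivity

lemma tendsto_poleCutoff {a : Fin n → EuclideanSpace ℝ (Fin N)}
    {x : EuclideanSpace ℝ (Fin N)} (hx : ∀ j, x ≠ a j) :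
    Tendsto (fun m => poleCutoff a m x) atTop (𝓝 1) := by
  have h1 : Tendsto (fun m : ℕ => ((m : ℝ) + 1) * poleProd a x - 1) atTop atTop := by
    refine tendsto_atTop_add_const_right _ _ (Tendsto.atTop_mul_const (poleProd_pos hx) ?_)
    exact tendsto_atTop_add_const_right _ _ tendsto_natCast_atTop_atTop
  refine tendsto_const_nhds.congr' ?_
  filter_upwards [h1.eventually_ge_atTop 1] with m hm
  exact (Real.smoothTransition.one_of_one_le hm).symm

lemma poleCutoff_eventually_eq_zero {a : Fin n → EuclideanSpace ℝ (Fin N)} (m : ℕ)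
    {x : EuclideanSpace ℝ (Fin N)} (hx : ¬ ∀ j, x ≠ a j) : poleCutoff a m =ᶠ[𝓝 x] 0 := by
  have h1 : ContinuousAt (fun y => ((m : ℝ) + 1) * poleProd a y - 1) x :=
    (((contDiff_poleProd a).continuous.const_mul _).sub continuous_const).continuousAt
  have h2 : ∀ᶠ y in 𝓝 x, ((m : ℝ) + 1) * poleProd a y - 1 < 0 :=
    h1.eventually_lt continuousAt_const (by simp [poleProd_eq_zero hx])
  filter_upwards [h2] with y hy
  exact Real.smoothTransition.zero_of_nonpos hy.le

/-- A smooth bump equal to `1` on the unit ball and supported in the ball of radius `2`. -/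
noncomputable def unitBump (N : ℕ) : ContDiffBump (0 : EuclideanSpace ℝ (Fin N)) :=
  ⟨1, 2, one_pos, one_lt_two⟩

/-- The cutoff at infinity at scale `R`. -/
noncomputable def farCutoff (R : ℝ) (x : EuclideanSpace ℝ (Fin N)) : ℝ := unitBump N (R⁻¹ • x)

lemma contDiff_farCutoff (R : ℝ) : ContDiff ℝ ∞ (farCutoff (N := N) R) :=
  (unitBump N).contDiff.comp (contDiff_id.const_smul R⁻¹)

lemma hasCompactSupport_farCutoff {R : ℝ} (hR : 0 < R) :
    HasCompactSupport (farCutoff (N := N) R) :=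
  (unitBump N).hasCompactSupport.comp_homeomorph (Homeomorph.smulOfNeZero R⁻¹ (by positivity))

lemma farCutoff_eq_one {R : ℝ} (hR : 0 < R) {x : EuclideanSpace ℝ (Fin N)} (hx : ‖x‖ ≤ R) :
    farCutoff R x = 1 := by
  refine (unitBump N).one_of_mem_closedBall ?_
  rw [mem_closedBall_zero_iff, norm_smul, norm_inv, Real.norm_of_nonneg hR.le,
    inv_mul_le_iff₀ hR]
  simpa [unitBump] using hx

lemma exists_norm_fderiv_unitBump_le (N : ℕ) :
    ∃ c : ℝ, ∀ x, ‖fderiv ℝ (unitBump N) x‖ ≤ c :=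
  ((unitBump N).contDiff.continuous_fderiv
    (n := 1) (by simp)).bounded_above_of_compact_support ((unitBump N).hasCompactSupport.fderiv ℝ)

lemma norm_fderiv_farCutoff_le {c : ℝ} (hc : ∀ x, ‖fderiv ℝ (unitBump N) x‖ ≤ c) {R : ℝ}
    (hR : 0 < R) (x : EuclideanSpace ℝ (Fin N)) :
    ‖fderiv ℝ (farCutoff (N := N) R) x‖ ≤ c / R := by
  have : fderiv ℝ (farCutoff (N := N) R) x = R⁻¹ • fderiv ℝ (unitBump N) (R⁻¹ • x) :=
    fderiv_comp_smul (f := unitBump N) R⁻¹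
  rw [this, norm_smul, norm_inv, Real.norm_of_nonneg hR.le, div_eq_inv_mul]
  exact mul_le_mul_of_nonneg_left (hc _) (by positivity)

lemma fderiv_farCutoff_eq_zero {R : ℝ} (hR : 0 < R) {x : EuclideanSpace ℝ (Fin N)}
    (hx : ‖x‖ < R) : fderiv ℝ (farCutoff (N := N) R) x = 0 := by
  have h : farCutoff (N := N) R =ᶠ[𝓝 x] fun _ => 1 := by
    filter_upwards [continuous_norm.continuousAt.eventually_lt continuousAt_const hx] with y hy
    exact farCutoff_eq_one hR hy.le
  rw [h.fderiv_eq]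
  simp

/-- The full cutoff: away from the poles and from infinity. -/
noncomputable def fieldCutoff (a : Fin n → EuclideanSpace ℝ (Fin N)) (m : ℕ) (R : ℝ)
    (x : EuclideanSpace ℝ (Fin N)) : ℝ :=
  poleCutoff a m x * farCutoff R x

lemma contDiff_fieldCutoff (a : Fin n → EuclideanSpace ℝ (Fin N)) (m : ℕ) (R : ℝ) :
    ContDiff ℝ ∞ (fieldCutoff a m R) :=
  (contDiff_poleCutoff a m).mul (contDiff_farCutoff R)

lemma fieldCutoff_nonneg (a : Fin n → EuclideanSpace ℝ (Fin N)) (m : ℕ) (R : ℝ)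
    (x : EuclideanSpace ℝ (Fin N)) : 0 ≤ fieldCutoff a m R x :=
  mul_nonneg (Real.smoothTransition.nonneg _) (unitBump N).nonneg

lemma fieldCutoff_le_one (a : Fin n → EuclideanSpace ℝ (Fin N)) (m : ℕ) (R : ℝ)
    (x : EuclideanSpace ℝ (Fin N)) : fieldCutoff a m R x ≤ 1 :=
  mul_le_one₀ (Real.smoothTransition.le_one _) (unitBump N).nonneg (unitBump N).le_one

/-- The only negative contribution to the derivative of the cutoff along the field comes from the
cutoff at infinity, and it is `O(1 / R)`. -/
lemma neg_le_fderiv_fieldCutoff_poleField {a : Fin n → EuclideanSpace ℝ (Fin N)} (m : ℕ)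
    {c : ℝ} (hc : ∀ x, ‖fderiv ℝ (unitBump N) x‖ ≤ c) {R : ℝ} (hR : 1 + ∑ j, ‖a j‖ ≤ R)
    {x : EuclideanSpace ℝ (Fin N)} (hx : ∀ j, x ≠ a j) :
    -(c / R * n) ≤ fderiv ℝ (fieldCutoff a m R) x (poleField a x) := by
  have hR1 : 1 ≤ R := by
    have : 0 ≤ ∑ j, ‖a j‖ := Finset.sum_nonneg fun j _ => norm_nonneg _
    linarith
  have hR0 : 0 < R := by linarith
  have hc0 : 0 ≤ c := (norm_nonneg _).trans (hc 0)
  have h : HasFDerivAt (fieldCutoff a m R) _ x :=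
    ((contDiff_poleCutoff a m).differentiable (by simp) x).hasFDerivAt.mul
      ((contDiff_farCutoff R).differentiable (by simp) x).hasFDerivAt
  have h1 := fderiv_poleCutoff_poleField_nonneg m hx
  have h2 : 0 ≤ farCutoff R x := (unitBump N).nonneg
  have h3 : 0 ≤ poleCutoff a m x := Real.smoothTransition.nonneg _
  have h4 : poleCutoff a m x ≤ 1 := Real.smoothTransition.le_one _
  rw [h.fderiv]
  simp only [add_apply, smul_apply, smul_eq_mul]
  have h5 : |fderiv ℝ (farCutoff (N := N) R) x (poleField a x)| ≤ c / R * n := by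
    rcases lt_or_ge ‖x‖ R with hxR | hxR
    · rw [fderiv_farCutoff_eq_zero hR0 hxR]
      simp only [zero_apply, abs_zero]
      positivity
    · have h6 : ∀ j, 1 ≤ ‖x - a j‖ := fun j => by
        have h7 : ‖a j‖ ≤ ∑ j, ‖a j‖ :=
          Finset.single_le_sum (f := fun j => ‖a j‖) (fun j _ => norm_nonneg _)
            (Finset.mem_univ j)
        have := norm_sub_norm_le x (a j)
        linarith
      rw [← Real.norm_eq_abs]
      refine (ContinuousLinearMap.le_opNorm _ _).trans ?_
      exact mul_le_mul (norm_fderiv_farCutoff_le hc hR0 x) (norm_poleField_le h6)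
        (norm_nonneg _) (by positivity)
  have h8 : |poleCutoff a m x * fderiv ℝ (farCutoff (N := N) R) x (poleField a x)|
      ≤ c / R * n := by
    rw [abs_mul, abs_of_nonneg h3]
    exact (mul_le_of_le_one_left (abs_nonneg _) h4).trans h5
  have h9 := neg_le_of_abs_le h8
  have h10 := mul_nonneg h2 h1
  linarith

/-- The field `β ∑ⱼ (x - aⱼ) / |x - aⱼ|²`, cut off near the poles and near infinity. -/
noncomputable def cutField (a : Fin n → EuclideanSpace ℝ (Fin N)) (β : ℝ) (m : ℕ) (R : ℝ)
    (x : EuclideanSpace ℝ (Fin N)) : EuclideanSpace ℝ (Fin N) :=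
  (fieldCutoff a m R x * β) • poleField a x

lemma contDiff_cutField_apply (a : Fin n → EuclideanSpace ℝ (Fin N)) (β : ℝ) (m : ℕ) (R : ℝ)
    (i : Fin N) : ContDiff ℝ ∞ (fun x => cutField a β m R x i) := by
  refine contDiff_iff_contDiffAt.2 fun x => ?_
  by_cases hx : ∀ j, x ≠ a j
  · have h : ContDiffAt ℝ ∞ (fun y => poleField a y i) x := by
      rw [poleField_apply]
      refine ContDiffAt.sum fun j _ => ?_
      refine ContDiffAt.mul (ContDiffAt.inv ?_ ?_) ?_
      · exact ((contDiff_id.sub contDiff_const).norm_sq ℝ).contDiffAt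
      · exact pow_ne_zero 2 (norm_ne_zero_iff.2 (sub_ne_zero.2 (hx j)))
      · exact ((EuclideanSpace.proj (𝕜 := ℝ) i).contDiff.comp
          (contDiff_id.sub contDiff_const)).contDiffAt
    exact ((contDiff_fieldCutoff a m R).contDiffAt.mul contDiffAt_const).mul h
  · refine (contDiffAt_const (c := (0 : ℝ))).congr_of_eventuallyEq ?_
    filter_upwards [poleCutoff_eventually_eq_zero m hx] with y hy
    simp [cutField, fieldCutoff, hy]

lemma hasCompactSupport_cutField_apply (a : Fin n → EuclideanSpace ℝ (Fin N)) (β : ℝ) (m : ℕ)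
    {R : ℝ} (hR : 0 < R) (i : Fin N) : HasCompactSupport (fun x => cutField a β m R x i) := by
  refine (hasCompactSupport_farCutoff (N := N) hR).mono fun x hx => ?_
  contrapose! hx
  have hx' : farCutoff R x = 0 := by simpa using hx
  simp [cutField, fieldCutoff, hx']

lemma sum_fderiv_cutField {a : Fin n → EuclideanSpace ℝ (Fin N)} (β : ℝ) (m : ℕ) (R : ℝ)
    {x : EuclideanSpace ℝ (Fin N)} (hx : ∀ j, x ≠ a j) :
    ∑ i, fderiv ℝ (fun y => cutField a β m R y i) x (EuclideanSpace.single i 1)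
      = β * (fieldCutoff a m R x * (((N : ℝ) - 2) * poleSum a x)
        + fderiv ℝ (fieldCutoff a m R) x (poleField a x)) := by
  have h : ∀ i, fderiv ℝ (fun y => cutField a β m R y i) x (EuclideanSpace.single i 1)
      = β * (fieldCutoff a m R x
          * fderiv ℝ (fun y => poleField a y i) x (EuclideanSpace.single i 1)
        + fderiv ℝ (fieldCutoff a m R) x (poleField a x i • EuclideanSpace.single i 1)) := by
    intro i
    have h1 : HasFDerivAt (fun y => cutField a β m R y i) _ x :=
      (((contDiff_fieldCutoff a m R).differentiable (by simp) x).hasFDerivAt.mul_const β).mul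
        (differentiableAt_poleField_apply hx i).hasFDerivAt
    rw [h1.fderiv]
    simp only [add_apply, smul_apply, smul_eq_mul, map_smul]
    change _ + poleField a x i * _ = _
    ring
  simp only [h, ← Finset.mul_sum, Finset.sum_add_distrib, sum_fderiv_poleField hx]
  rw [← map_sum]
  congr 3
  ext i
  simp [Finset.sum_apply, Pi.single_apply]

/-! ### The energy inequality for a test field -/

lemma integrable_bdd_mul_mul_of_locallyIntegrable {b f ψ : EuclideanSpace ℝ (Fin N) → ℝ}
    (hf : LocallyIntegrable f) (hψ : Continuous ψ) (hc : HasCompactSupport ψ)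
    (hb : AEStronglyMeasurable b) (hbd : ∃ C, ∀ x, ‖b x‖ ≤ C) :
    Integrable (fun x => b x * f x * ψ x) := by
  obtain ⟨C, hC⟩ := hbd
  have := (integrable_mul_of_locallyIntegrable hf hψ hc).bdd_mul hb
    (Eventually.of_forall hC)
  simpa only [mul_assoc] using this

/-- Expanding `|T'(φ) ∇φ + T(φ) Ψ|² ≥ 0`, with `T` a truncation, and integrating the mixed term by
parts against the weight `w²`. -/
lemma integral_trunc_sq_mul_le {φ w : EuclideanSpace ℝ (Fin N) → ℝ}
    {g k Ψ : EuclideanSpace ℝ (Fin N) → EuclideanSpace ℝ (Fin N)}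
    (hφ : HasWeakGradient φ g) (hw : HasWeakGradient w k)
    (hw2 : LocallyIntegrable (fun x => w x ^ 2)) (hwk : LocallyIntegrable (fun x => w x • k x))
    (hwg : LocallyIntegrable (fun x => w x ^ 2 • g x))
    (hg2 : Integrable (fun x => w x ^ 2 * ‖g x‖ ^ 2))
    (hΨ : ∀ i, ContDiff ℝ ∞ (fun x => Ψ x i)) (hc : ∀ i, HasCompactSupport (fun x => Ψ x i))
    {c : ℝ} (hc1 : 1 ≤ c) :
    Integrable (fun x => trunc c (φ x) ^ 2 * (w x ^ 2 *
        ∑ i, fderiv ℝ (fun y => Ψ y i) x (EuclideanSpace.single i 1)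
        + inner ℝ ((2 : ℝ) • w x • k x) (Ψ x) - w x ^ 2 * ‖Ψ x‖ ^ 2)) ∧
    ∫ x, trunc c (φ x) ^ 2 * (w x ^ 2 *
        ∑ i, fderiv ℝ (fun y => Ψ y i) x (EuclideanSpace.single i 1)
        + inner ℝ ((2 : ℝ) • w x • k x) (Ψ x) - w x ^ 2 * ‖Ψ x‖ ^ 2)
      ≤ ∫ x, w x ^ 2 * ‖g x‖ ^ 2 := by
  have hS := boundedC1_trunc_sq hc1
  have hφm := hφ.1.aestronglyMeasurable
  have hSm : AEStronglyMeasurable (fun x => trunc c (φ x) ^ 2) :=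
    hS.continuous.comp_aestronglyMeasurable hφm
  have hS'm : AEStronglyMeasurable (fun x => 2 * trunc c (φ x) * truncDeriv c (φ x)) :=
    hS.continuous_deriv.comp_aestronglyMeasurable hφm
  have hSb : ∃ C, ∀ x, ‖trunc c (φ x) ^ 2‖ ≤ C := hS.bound.imp fun C h x => h _
  have hS'b : ∃ C, ∀ x, ‖2 * trunc c (φ x) * truncDeriv c (φ x)‖ ≤ C :=
    hS.bound_deriv.imp fun C h x => h _
  have hi1 : ∀ i, Integrable (fun x => trunc c (φ x) ^ 2 * w x ^ 2 *
      fderiv ℝ (fun y => Ψ y i) x (EuclideanSpace.single i 1)) := fun i =>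
    integrable_bdd_mul_mul_of_locallyIntegrable hw2
      (((hΨ i).continuous_fderiv (by simp)).clm_apply continuous_const)
      ((hc i).fderiv_apply (𝕜 := ℝ) _) hSm hSb
  have hi2 : ∀ i, Integrable (fun x => 2 * trunc c (φ x) * truncDeriv c (φ x) * w x ^ 2 * g x i *
      Ψ x i) := fun i => by
    have := integrable_bdd_mul_mul_of_locallyIntegrable (locallyIntegrable_apply hwg i)
      (hΨ i).continuous (hc i) hS'm hS'b
    simpa [mul_assoc] using this
  have hi3 : ∀ i, Integrable (fun x => trunc c (φ x) ^ 2 * (2 * w x * k x i) * Ψ x i) :=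
      fun i => by
    have := integrable_bdd_mul_mul_of_locallyIntegrable
      (locallyIntegrable_apply (hwk.smul (2 : ℝ)) i) (hΨ i).continuous (hc i) hSm hSb
    simpa [mul_assoc] using this
  have hi4 : Integrable (fun x => trunc c (φ x) ^ 2 * w x ^ 2 * ‖Ψ x‖ ^ 2) := by
    have h : ∀ x, trunc c (φ x) ^ 2 * w x ^ 2 * ‖Ψ x‖ ^ 2
        = ∑ i, trunc c (φ x) ^ 2 * w x ^ 2 * (Ψ x i * Ψ x i) := fun x => by
      rw [EuclideanSpace.norm_sq_eq, Finset.mul_sum]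
      simp [pow_two]
    simp only [h]
    exact integrable_finsetSum _ fun i _ => integrable_bdd_mul_mul_of_locallyIntegrable hw2
      ((hΨ i).continuous.mul (hΨ i).continuous) (hc i).mul_left hSm hSb
  have hexp : ∀ x, trunc c (φ x) ^ 2 * (w x ^ 2 *
        ∑ i, fderiv ℝ (fun y => Ψ y i) x (EuclideanSpace.single i 1)
        + inner ℝ ((2 : ℝ) • w x • k x) (Ψ x) - w x ^ 2 * ‖Ψ x‖ ^ 2)
      = ∑ i, (trunc c (φ x) ^ 2 * w x ^ 2 *
          fderiv ℝ (fun y => Ψ y i) x (EuclideanSpace.single i 1)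
        + trunc c (φ x) ^ 2 * (2 * w x * k x i) * Ψ x i)
        - trunc c (φ x) ^ 2 * w x ^ 2 * ‖Ψ x‖ ^ 2 := fun x => by
    have h : inner ℝ ((2 : ℝ) • w x • k x) (Ψ x) = ∑ i, 2 * w x * k x i * Ψ x i := by
      simp only [PiLp.inner_apply, PiLp.smul_apply, smul_eq_mul, RCLike.inner_apply, conj_trivial]
      exact Finset.sum_congr rfl fun i _ => by ring
    rw [h, Finset.sum_add_distrib, mul_sub, mul_add, Finset.mul_sum, Finset.mul_sum,
      Finset.mul_sum]
    simp only [mul_assoc]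
  simp only [hexp]
  have hi13 : ∀ i, Integrable (fun x => trunc c (φ x) ^ 2 * w x ^ 2 *
          fderiv ℝ (fun y => Ψ y i) x (EuclideanSpace.single i 1)
        + trunc c (φ x) ^ 2 * (2 * w x * k x i) * Ψ x i) := fun i => (hi1 i).add (hi3 i)
  have hi13s := integrable_finsetSum Finset.univ fun i _ => hi13 i
  refine ⟨hi13s.sub hi4, ?_⟩
  have hparts : ∀ i, ∫ x, (trunc c (φ x) ^ 2 * w x ^ 2 *
          fderiv ℝ (fun y => Ψ y i) x (EuclideanSpace.single i 1)
        + trunc c (φ x) ^ 2 * (2 * w x * k x i) * Ψ x i)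
      = - ∫ x, 2 * trunc c (φ x) * truncDeriv c (φ x) * w x ^ 2 * g x i * Ψ x i := fun i => by
    rw [integral_add (hi1 i) (hi3 i),
      integral_comp_mul_sq_mul_fderiv hS hφ hw hw2 hwk hwg (hΨ i) (hc i) i]
    ring
  rw [integral_sub hi13s hi4, integral_finsetSum _ fun i _ => hi13 i]
  simp only [hparts]
  rw [Finset.sum_neg_distrib, ← integral_finsetSum _ fun i _ => hi2 i]
  have hi2s : Integrable (fun x => ∑ i, 2 * trunc c (φ x) * truncDeriv c (φ x) * w x ^ 2 * g x i *
      Ψ x i) := integrable_finsetSum _ fun i _ => hi2 i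
  have hsq : 0 ≤ ∫ x, (w x ^ 2 * ‖g x‖ ^ 2
      + ∑ i, 2 * trunc c (φ x) * truncDeriv c (φ x) * w x ^ 2 * g x i * Ψ x i
      + trunc c (φ x) ^ 2 * w x ^ 2 * ‖Ψ x‖ ^ 2) := by
    refine integral_nonneg fun x => ?_
    have h1 : ∑ i, 2 * trunc c (φ x) * truncDeriv c (φ x) * w x ^ 2 * g x i * Ψ x i
        = 2 * trunc c (φ x) * truncDeriv c (φ x) * w x ^ 2 * inner ℝ (g x) (Ψ x) := by
      simp only [PiLp.inner_apply, RCLike.inner_apply, conj_trivial, Finset.mul_sum]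
      exact Finset.sum_congr rfl fun i _ => by ring
    have h2 : 0 ≤ ‖truncDeriv c (φ x) • g x + trunc c (φ x) • Ψ x‖ ^ 2 := by positivity
    rw [norm_add_sq_real, norm_smul, norm_smul, mul_pow, mul_pow, real_inner_smul_left,
      real_inner_smul_right, Real.norm_eq_abs, Real.norm_eq_abs, sq_abs, sq_abs] at h2
    -- As `|T'| ≤ 1`, the term `|T'(φ)|² |∇φ|²` is at most `|∇φ|²`.
    have h3 : truncDeriv c (φ x) ^ 2 ≤ 1 := by
      rw [← sq_abs]; exact pow_le_one₀ (abs_nonneg _) (abs_truncDeriv_le hc1 _)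
    have h4 : truncDeriv c (φ x) ^ 2 * ‖g x‖ ^ 2 ≤ ‖g x‖ ^ 2 :=
      mul_le_of_le_one_left (by positivity) h3
    have h5 : 0 ≤ w x ^ 2 * (‖g x‖ ^ 2 + 2 * (truncDeriv c (φ x) * (trunc c (φ x) *
        inner ℝ (g x) (Ψ x))) + trunc c (φ x) ^ 2 * ‖Ψ x‖ ^ 2) :=
      mul_nonneg (by positivity) (by linarith)
    simp only [Pi.zero_apply]
    rw [h1]
    linarith
  have hsplit : ∫ x, (w x ^ 2 * ‖g x‖ ^ 2
      + ∑ i, 2 * trunc c (φ x) * truncDeriv c (φ x) * w x ^ 2 * g x i * Ψ x i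
      + trunc c (φ x) ^ 2 * w x ^ 2 * ‖Ψ x‖ ^ 2)
      = (∫ x, w x ^ 2 * ‖g x‖ ^ 2)
      + (∫ x, ∑ i, 2 * trunc c (φ x) * truncDeriv c (φ x) * w x ^ 2 * g x i * Ψ x i)
      + ∫ x, trunc c (φ x) ^ 2 * w x ^ 2 * ‖Ψ x‖ ^ 2 := by
    rw [← integral_add hg2 hi2s]
    exact integral_add (hg2.add hi2s) hi4
  rw [hsplit] at hsq
  linarith

/-! ### The Hardy potential -/

lemma functionW_eq (μ : EuclideanSpace ℝ (Fin N) → ℝ) (a : Fin n → EuclideanSpace ℝ (Fin N))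
    (K : ℝ) (x : EuclideanSpace ℝ (Fin N)) :
    functionW μ a K x = betaConst N n K * (K * poleSum a x
      - inner ℝ (weakGrad μ x) (poleField a x) / μ x) := by
  rw [functionW, poleSum, poleField, inner_sum, Finset.mul_sum, Finset.sum_div,
    ← Finset.sum_sub_distrib, Finset.mul_sum, ← Finset.sum_neg_distrib]
  refine Finset.sum_congr rfl fun j _ => ?_
  rw [real_inner_smul_right, real_inner_comm]
  ring

lemma potentialV_nonneg (a : Fin n → EuclideanSpace ℝ (Fin N)) (x : EuclideanSpace ℝ (Fin N)) :
    0 ≤ potentialV a x := by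
  unfold potentialV
  refine mul_nonneg (by norm_num) (Finset.sum_nonneg fun i _ => Finset.sum_nonneg fun j _ => ?_)
  split_ifs <;> positivity

lemma measurable_potentialV (a : Fin n → EuclideanSpace ℝ (Fin N)) :
    Measurable (potentialV a) := by
  unfold potentialV
  refine Measurable.const_mul (Finset.measurable_fun_sum _ fun i _ =>
    Finset.measurable_fun_sum _ fun j _ => ?_) _
  split_ifs
  · fun_prop
  · exact measurable_const

/-- For the cut-off field `Ψ` of slope `β` with `β n = N + K - 2`, the expression
`div Ψ + ∇μ/μ · Ψ - |Ψ|²` dominates the cut-off `θ` times `β² V - W`, up to an error `O(1 / R)`. -/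
lemma fieldCutoff_mul_le {μ : EuclideanSpace ℝ (Fin N) → ℝ}
    {a : Fin n → EuclideanSpace ℝ (Fin N)} {K : ℝ} (hn : 1 ≤ n)
    (hβ : 0 < betaConst N n K) (m : ℕ) {c : ℝ} (hc : ∀ x, ‖fderiv ℝ (unitBump N) x‖ ≤ c)
    {R : ℝ} (hR : 1 + ∑ j, ‖a j‖ ≤ R) {x : EuclideanSpace ℝ (Fin N)} (hx : ∀ j, x ≠ a j)
    (hμ : 0 < μ x) :
    μ x * (fieldCutoff a m R x * (betaConst N n K ^ 2 * potentialV a x - functionW μ a K x)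
        - betaConst N n K * (c / R * n))
      ≤ μ x * ∑ i, fderiv ℝ (fun y => cutField a (betaConst N n K) m R y i) x
          (EuclideanSpace.single i 1)
        + inner ℝ (weakGrad μ x) (cutField a (betaConst N n K) m R x)
        - μ x * ‖cutField a (betaConst N n K) m R x‖ ^ 2 := by
  set β := betaConst N n K with hβdef
  have hnβ : β * n = N + K - 2 := by
    rw [hβdef, betaConst, div_mul_cancel₀]
    have : (0 : ℝ) < n := by exact_mod_cast hn
    exact this.ne'
  have h1 := neg_le_fderiv_fieldCutoff_poleField m hc hR hx
  have h2 := norm_poleField_sq hx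
  rw [sum_fderiv_cutField β m R hx, functionW_eq, ← hβdef, cutField, norm_smul, mul_pow,
    Real.norm_eq_abs, sq_abs, real_inner_smul_right, h2]
  set θ := fieldCutoff a m R x
  have hθ0 : 0 ≤ θ := fieldCutoff_nonneg a m R x
  have hθ1 : θ ≤ 1 := fieldCutoff_le_one a m R x
  set I := inner ℝ (weakGrad μ x) (poleField a x)
  have hI : θ * β * I = μ x * (θ * β * (I / μ x)) := by field_simp
  rw [hI]
  -- Replacing `θ² |F|²` by `θ |F|²` is allowed since `0 ≤ θ ≤ 1`.
  have h3 : 0 ≤ θ * (1 - θ) * β ^ 2 * (n * poleSum a x - potentialV a x) := by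
    have : 0 ≤ n * poleSum a x - potentialV a x := by rw [← h2]; positivity
    have : 0 ≤ 1 - θ := by linarith
    positivity
  have h4 := mul_le_mul_of_nonneg_left h1 hβ.le
  have h5 : θ * β * poleSum a x * (β * n) = θ * β * poleSum a x * (N + K - 2) := by rw [hnβ]
  rw [← mul_add, ← mul_sub]
  refine mul_le_mul_of_nonneg_left ?_ hμ.le
  linarith

/-! ### The weighted measure -/

lemma CondH1.aemeasurable {μ : EuclideanSpace ℝ (Fin N) → ℝ} (h1 : CondH1 μ) :
    AEMeasurable μ := by
  refine h1.inv_locInt.aestronglyMeasurable.aemeasurable.inv.congr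
    (Filter.Eventually.of_forall fun x => ?_)
  simp

lemma toReal_ofReal_eq_sqrt_sq (r : ℝ) : (ENNReal.ofReal r).toReal = Real.sqrt r ^ 2 := by
  rw [ENNReal.toReal_ofReal', Real.sq_sqrt']

/-- The density is written as `(√μ)²`, which agrees with `ENNReal.ofReal μ` also where `μ < 0`. -/
lemma integrable_weightMeasure_iff {μ : EuclideanSpace ℝ (Fin N) → ℝ} (hμ : AEMeasurable μ)
    (f : EuclideanSpace ℝ (Fin N) → ℝ) :
    Integrable f (weightMeasure μ) ↔ Integrable (fun x => Real.sqrt (μ x) ^ 2 * f x) := by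
  rw [weightMeasure, integrable_withDensity_iff_integrable_smul₀' hμ.ennreal_ofReal (by simp)]
  simp only [toReal_ofReal_eq_sqrt_sq, smul_eq_mul]

lemma integral_weightMeasure {μ : EuclideanSpace ℝ (Fin N) → ℝ} (hμ : AEMeasurable μ)
    (f : EuclideanSpace ℝ (Fin N) → ℝ) :
    ∫ x, f x ∂(weightMeasure μ) = ∫ x, Real.sqrt (μ x) ^ 2 * f x := by
  rw [weightMeasure, integral_withDensity_eq_integral_toReal_smul₀ hμ.ennreal_ofReal (by simp)]
  simp only [toReal_ofReal_eq_sqrt_sq, smul_eq_mul]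

lemma locallyIntegrable_smul_of_memLp_two {F : Type*} [NormedAddCommGroup F] [NormedSpace ℝ F]
    {w : EuclideanSpace ℝ (Fin N) → ℝ} {f : EuclideanSpace ℝ (Fin N) → F}
    (hw : ∀ s, IsCompact s → MemLp w 2 (volume.restrict s))
    (hf : ∀ s, IsCompact s → MemLp f 2 (volume.restrict s)) :
    LocallyIntegrable (fun x => w x • f x) := by
  refine locallyIntegrable_iff.2 fun s hs => ?_
  have : MemLp (w • f) 1 (volume.restrict s) := (hf s hs).smul (hw s hs)
  exact memLp_one_iff_integrable.1 this

lemma ae_forall_ne (hN : 1 ≤ N) (a : Fin n → EuclideanSpace ℝ (Fin N)) :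
    ∀ᵐ x, ∀ j, x ≠ a j := by
  have : Nonempty (Fin N) := ⟨⟨0, hN⟩⟩
  refine ae_all_iff.2 fun j => ?_
  exact compl_mem_ae_iff.2 (measure_singleton (a j))

/-! ### The limit of the energy inequalities -/

/-- The Hardy inequality with respect to the Lebesgue measure, with the weight written as
`(√μ)²`. The energy inequalities for the cut-off fields and the truncations of `φ` bound the
integrals of nonnegative functions converging to `μ φ² (β² V + |C| - W)`, and Fatou's lemma gives
the integrability of the limit together with the bound. -/
lemma hardy_inequality_volume (hN : 1 ≤ N) (hn : 1 ≤ n)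
    {a : Fin n → EuclideanSpace ℝ (Fin N)} {μ : EuclideanSpace ℝ (Fin N) → ℝ} {C K : ℝ}
    (h1 : CondH1 μ) (h2 : CondH2 μ a C K) {φ : EuclideanSpace ℝ (Fin N) → ℝ}
    {g : EuclideanSpace ℝ (Fin N) → EuclideanSpace ℝ (Fin N)} (hφ : HasWeakGradient φ g)
    (hφ2 : Integrable (fun x => Real.sqrt (μ x) ^ 2 * φ x ^ 2))
    (hg2 : Integrable (fun x => Real.sqrt (μ x) ^ 2 * ‖g x‖ ^ 2)) :
    Integrable (fun x => Real.sqrt (μ x) ^ 2 * (potentialV a x * φ x ^ 2)) ∧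
    Integrable (fun x => Real.sqrt (μ x) ^ 2 * (functionW μ a K x * φ x ^ 2)) ∧
    betaConst N n K ^ 2 * ∫ x, Real.sqrt (μ x) ^ 2 * (potentialV a x * φ x ^ 2)
      ≤ (∫ x, Real.sqrt (μ x) ^ 2 * ‖g x‖ ^ 2)
        + ∫ x, Real.sqrt (μ x) ^ 2 * (functionW μ a K x * φ x ^ 2) := by
  set w : EuclideanSpace ℝ (Fin N) → ℝ := fun x => Real.sqrt (μ x) with hwdef
  obtain ⟨hwL2, k, hwk, hkL2⟩ := h1.sqrt_mem
  change HasWeakGradient w k at hwk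
  change Integrable (fun x => w x ^ 2 * φ x ^ 2) at hφ2
  change Integrable (fun x => w x ^ 2 * ‖g x‖ ^ 2) at hg2
  have hβ : 0 < betaConst N n K := by
    have : (0 : ℝ) < n := by exact_mod_cast hn
    have := h2.lt_K
    unfold betaConst
    apply div_pos <;> linarith
  set β := betaConst N n K with hβdef
  have hwm : AEStronglyMeasurable w := hwk.1.aestronglyMeasurable
  have hgm : AEStronglyMeasurable g := hφ.2.1.aestronglyMeasurable
  have hφm : AEStronglyMeasurable φ := hφ.1.aestronglyMeasurable
  have hwμ : ∀ᵐ x, w x ^ 2 = μ x := by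
    filter_upwards [h1.pos] with x hx using Real.sq_sqrt hx.le
  have hw2 : LocallyIntegrable (fun x => w x ^ 2) := by
    simpa [pow_two] using locallyIntegrable_smul_of_memLp_two hwL2 hwL2
  have hwkl : LocallyIntegrable (fun x => w x • k x) :=
    locallyIntegrable_smul_of_memLp_two hwL2 hkL2
  have hwgL2 : MemLp (fun x => w x • g x) 2 volume := by
    refine (memLp_two_iff_integrable_sq_norm (hwm.smul hgm)).2 ?_
    refine hg2.congr (Eventually.of_forall fun x => ?_)
    simp [norm_smul, mul_pow]
  have hwg : LocallyIntegrable (fun x => w x ^ 2 • g x) := by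
    have := locallyIntegrable_smul_of_memLp_two hwL2 (fun s _ => hwgL2.restrict s)
    simpa [smul_smul, pow_two] using this
  -- The weak gradient of `μ = (√μ)²` is `2 √μ ∇√μ`.
  have hM : weakGrad μ =ᵐ[volume] fun x => (2 : ℝ) • w x • k x :=
    weakGrad_ae_eq ((hasWeakGradient_sq hwk hw2 hwkl).congr_ae hwμ)
  have hμm := h1.aemeasurable
  have hWm : AEMeasurable (functionW μ a K) := by
    have hMm : AEMeasurable (weakGrad μ) :=
      ((hwkl.aestronglyMeasurable.const_smul (2 : ℝ)).aemeasurable).congr hM.symm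
    unfold functionW
    refine (Finset.aemeasurable_fun_sum _ fun j _ => ?_).neg
    refine AEMeasurable.mul (Measurable.aemeasurable (by fun_prop)) ?_
    refine AEMeasurable.sub_const (AEMeasurable.div ?_ hμm) K
    exact AEMeasurable.inner (Measurable.aemeasurable (by fun_prop)) hMm
  have hVm := measurable_potentialV a
  obtain ⟨c, hc⟩ := exists_norm_fderiv_unitBump_le N
  set R : ℕ → ℝ := fun m => (m : ℝ) + (1 + ∑ j, ‖a j‖) with hRdef
  have hsum : 0 ≤ ∑ j, ‖a j‖ := Finset.sum_nonneg fun j _ => norm_nonneg _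
  have hRge : ∀ m, 1 + ∑ j, ‖a j‖ ≤ R m := fun m => by
    simp only [hRdef]
    linarith [(Nat.cast_nonneg m : (0 : ℝ) ≤ m)]
  have hRpos : ∀ m, 0 < R m := fun m => by linarith [hRge m]
  have hRtop : Tendsto R atTop atTop :=
    tendsto_atTop_add_const_right _ _ tendsto_natCast_atTop_atTop
  have hc0 : 0 ≤ c := (norm_nonneg _).trans (hc 0)
  set κ : ℕ → ℝ := fun m => β * (c / R m * n) with hκdef
  have hκ0 : ∀ m, 0 ≤ κ m := fun m => by
    have := hRpos m
    simp only [hκdef]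
    positivity
  have hκlim : Tendsto κ atTop (𝓝 0) := by
    have := ((hRtop.const_div_atTop c).mul_const (n : ℝ)).const_mul β
    simpa using this
  -- `D` is nonnegative because `W ≤ C`, which is what makes Fatou's lemma applicable.
  set D : EuclideanSpace ℝ (Fin N) → ℝ :=
    fun x => β ^ 2 * potentialV a x + |C| - functionW μ a K x with hDdef
  have hD0 : ∀ᵐ x, 0 ≤ D x := by
    filter_upwards [h2.W_le] with x hx
    have h3 := potentialV_nonneg a x
    have h4 := le_abs_self C
    have : 0 ≤ β ^ 2 * potentialV a x := by positivity
    simp only [hDdef]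
    linarith
  have hDm : AEMeasurable D := ((hVm.const_mul _).add_const _).aemeasurable.sub hWm
  set E := ∫ x, w x ^ 2 * ‖g x‖ ^ 2 with hE
  set J := ∫ x, w x ^ 2 * φ x ^ 2 with hJ
  have hE0 : 0 ≤ E := integral_nonneg fun x => by positivity
  have hJ0 : 0 ≤ J := integral_nonneg fun x => by positivity
  have hlevel : ∀ m : ℕ, (1 : ℝ) ≤ (m : ℝ) + 1 := fun m => by
    linarith [(Nat.cast_nonneg m : (0 : ℝ) ≤ m)]
  set f : ℕ → EuclideanSpace ℝ (Fin N) → ℝ := fun m x =>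
    fieldCutoff a m (R m) x * trunc ((m : ℝ) + 1) (φ x) ^ 2 * (w x ^ 2 * D x) with hfdef
  have hSm : ∀ m : ℕ, AEStronglyMeasurable (fun x => trunc ((m : ℝ) + 1) (φ x) ^ 2) := fun m =>
    (boundedC1_trunc_sq (hlevel m)).continuous.comp_aestronglyMeasurable hφm
  have hfm : ∀ m, AEMeasurable (f m) := fun m =>
    ((contDiff_fieldCutoff a m (R m)).continuous.measurable.aemeasurable.mul
      (hSm m).aemeasurable).mul ((hwm.aemeasurable.pow_const 2).mul hDm)
  have hbound : ∀ m, ∫⁻ x, ENNReal.ofReal (f m x)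
      ≤ ENNReal.ofReal (E + (|C| + κ m) * J) := by
    intro m
    obtain ⟨hint, hle⟩ := integral_trunc_sq_mul_le hφ hwk hw2 hwkl hwg hg2
      (contDiff_cutField_apply a β m (R m))
      (hasCompactSupport_cutField_apply a β m (hRpos m)) (hlevel m)
    have hsq_le : ∀ x, trunc ((m : ℝ) + 1) (φ x) ^ 2 ≤ φ x ^ 2 := fun x =>
      sq_le_sq.2 (abs_trunc_le (hlevel m) _)
    have hSint : Integrable (fun x => w x ^ 2 * trunc ((m : ℝ) + 1) (φ x) ^ 2) := by
      refine hφ2.mono' ((hwm.pow 2).mul (hSm m)) (Eventually.of_forall fun x => ?_)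
      rw [Real.norm_of_nonneg (by positivity)]
      exact mul_le_mul_of_nonneg_left (hsq_le x) (by positivity)
    have hSle : ∫ x, w x ^ 2 * trunc ((m : ℝ) + 1) (φ x) ^ 2 ≤ J :=
      integral_mono hSint hφ2 fun x => mul_le_mul_of_nonneg_left (hsq_le x) (by positivity)
    have hHint := hint.add (hSint.const_mul (|C| + κ m))
    have hpt : ∀ᵐ x, 0 ≤ f m x ∧ f m x ≤ trunc ((m : ℝ) + 1) (φ x) ^ 2 * (w x ^ 2 *
        ∑ i, fderiv ℝ (fun y => cutField a β m (R m) y i) x (EuclideanSpace.single i 1)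
        + inner ℝ ((2 : ℝ) • w x • k x) (cutField a β m (R m) x)
        - w x ^ 2 * ‖cutField a β m (R m) x‖ ^ 2)
        + (|C| + κ m) * (w x ^ 2 * trunc ((m : ℝ) + 1) (φ x) ^ 2) := by
      filter_upwards [ae_forall_ne hN a, h1.pos, hwμ, hM, hD0] with x hx hpos hwx hMx hDx
      have h3 := fieldCutoff_mul_le hn hβ m hc (hRge m) hx hpos
      rw [hMx, ← hwx] at h3
      have hθ0 := fieldCutoff_nonneg a m (R m) x
      have hθ1 := fieldCutoff_le_one a m (R m) x
      refine ⟨by simp only [hfdef]; positivity, ?_⟩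
      have h4 := mul_le_mul_of_nonneg_left h3 (sq_nonneg (trunc ((m : ℝ) + 1) (φ x)))
      have h5 : 0 ≤ (1 - fieldCutoff a m (R m) x) * |C| *
          (w x ^ 2 * trunc ((m : ℝ) + 1) (φ x) ^ 2) := by
        have : 0 ≤ 1 - fieldCutoff a m (R m) x := by linarith
        positivity
      simp only [hfdef, hDdef, hκdef]
      linarith
    calc ∫⁻ x, ENNReal.ofReal (f m x) ≤ _ :=
          lintegral_mono_ae (hpt.mono fun x hx => ENNReal.ofReal_le_ofReal hx.2)
      _ = _ := (ofReal_integral_eq_lintegral_ofReal hHint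
          (hpt.mono fun x hx => hx.1.trans hx.2)).symm
      _ ≤ _ := by
        refine ENNReal.ofReal_le_ofReal ?_
        refine (integral_add hint (hSint.const_mul (|C| + κ m))).trans_le ?_
        rw [integral_const_mul]
        have := mul_le_mul_of_nonneg_left hSle (add_nonneg (abs_nonneg C) (hκ0 m))
        linarith
  have hlim : ∀ᵐ x, Tendsto (fun m => ENNReal.ofReal (f m x)) atTop
      (𝓝 (ENNReal.ofReal (w x ^ 2 * φ x ^ 2 * D x))) := by
    filter_upwards [ae_forall_ne hN a] with x hx
    refine (ENNReal.continuous_ofReal.tendsto _).comp ?_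
    have h3 : Tendsto (fun m => fieldCutoff a m (R m) x) atTop (𝓝 1) := by
      refine (tendsto_poleCutoff hx).congr' ?_
      filter_upwards [hRtop.eventually_ge_atTop ‖x‖] with m hm
      rw [fieldCutoff, farCutoff_eq_one (hRpos m) hm, mul_one]
    have h4 := (h3.mul ((tendsto_trunc (φ x)).pow 2)).mul_const (w x ^ 2 * D x)
    convert h4 using 2
    ring
  have hfatou : ∫⁻ x, ENNReal.ofReal (w x ^ 2 * φ x ^ 2 * D x)
      ≤ ENNReal.ofReal (E + |C| * J) := by
    have h3 : Tendsto (fun m => ENNReal.ofReal (E + (|C| + κ m) * J)) atTop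
        (𝓝 (ENNReal.ofReal (E + |C| * J))) := by
      refine (ENNReal.continuous_ofReal.tendsto _).comp ?_
      have := ((hκlim.const_add |C|).mul_const J).const_add E
      simpa using this
    calc ∫⁻ x, ENNReal.ofReal (w x ^ 2 * φ x ^ 2 * D x)
        = ∫⁻ x, liminf (fun m => ENNReal.ofReal (f m x)) atTop :=
          lintegral_congr_ae (hlim.mono fun x hx => hx.liminf_eq.symm)
      _ ≤ liminf (fun m => ∫⁻ x, ENNReal.ofReal (f m x)) atTop :=
          lintegral_liminf_le' fun m => (hfm m).ennreal_ofReal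
      _ ≤ liminf (fun m => ENNReal.ofReal (E + (|C| + κ m) * J)) atTop :=
          liminf_le_liminf (Eventually.of_forall hbound)
      _ = _ := h3.liminf_eq
  have hFm : AEStronglyMeasurable (fun x => w x ^ 2 * φ x ^ 2 * D x) :=
    ((hwm.pow 2).mul (hφm.pow 2)).mul hDm.aestronglyMeasurable
  have hF0 : 0 ≤ᵐ[volume] fun x => w x ^ 2 * φ x ^ 2 * D x := by
    filter_upwards [hD0] with x hx
    exact mul_nonneg (by positivity) hx
  have hFint : Integrable (fun x => w x ^ 2 * φ x ^ 2 * D x) := by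
    refine ⟨hFm, ?_⟩
    rw [hasFiniteIntegral_iff_ofReal hF0]
    exact hfatou.trans_lt ENNReal.ofReal_lt_top
  have hFle : ∫ x, w x ^ 2 * φ x ^ 2 * D x ≤ E + |C| * J := by
    rw [integral_eq_lintegral_of_nonneg_ae hF0 hFm]
    exact ENNReal.toReal_le_of_le_ofReal (by positivity) hfatou
  have hVint : Integrable (fun x => w x ^ 2 * (potentialV a x * φ x ^ 2)) := by
    refine (hFint.const_mul (β ^ 2)⁻¹).mono'
      ((hwm.pow 2).mul (hVm.aestronglyMeasurable.mul (hφm.pow 2))) ?_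
    filter_upwards [h2.W_le] with x hx
    have h3 := potentialV_nonneg a x
    rw [Real.norm_of_nonneg (by positivity), inv_mul_eq_div, le_div_iff₀ (by positivity)]
    have h4 : β ^ 2 * potentialV a x ≤ D x := by
      simp only [hDdef]
      linarith [le_abs_self C]
    have h5 := mul_le_mul_of_nonneg_left h4 (by positivity : 0 ≤ w x ^ 2 * φ x ^ 2)
    linarith
  have hWeq : ∀ x, w x ^ 2 * (functionW μ a K x * φ x ^ 2)
      = β ^ 2 * (w x ^ 2 * (potentialV a x * φ x ^ 2)) + |C| * (w x ^ 2 * φ x ^ 2)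
        - w x ^ 2 * φ x ^ 2 * D x := fun x => by
    simp only [hDdef]
    ring
  have hVCint : Integrable (fun x => β ^ 2 * (w x ^ 2 * (potentialV a x * φ x ^ 2))
      + |C| * (w x ^ 2 * φ x ^ 2)) := (hVint.const_mul _).add (hφ2.const_mul _)
  refine ⟨hVint, ?_, ?_⟩
  · change Integrable (fun x => w x ^ 2 * (functionW μ a K x * φ x ^ 2))
    simp only [hWeq]
    exact hVCint.sub hFint
  · change β ^ 2 * ∫ x, w x ^ 2 * (potentialV a x * φ x ^ 2)
      ≤ E + ∫ x, w x ^ 2 * (functionW μ a K x * φ x ^ 2)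
    simp only [hWeq]
    rw [integral_sub hVCint hFint, integral_add (hVint.const_mul _) (hφ2.const_mul _),
      integral_const_mul, integral_const_mul]
    linarith

end MultipolarHardy

theorem theorem2p1 (N n : ℕ) (hN : 1 ≤ N) (hn : 1 ≤ n)
    (a : Fin n → EuclideanSpace ℝ (Fin N))
    (μ : EuclideanSpace ℝ (Fin N) → ℝ) (C K : ℝ)
    (h1 : MultipolarHardy.CondH1 μ)
    (h2 : MultipolarHardy.CondH2 μ a C K)
    (φ : EuclideanSpace ℝ (Fin N) → ℝ)
    (hφ : MultipolarHardy.MemH1Weighted μ φ) :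
    Integrable (fun x => MultipolarHardy.potentialV a x * φ x ^ 2)
        (MultipolarHardy.weightMeasure μ) ∧
    Integrable (fun x => MultipolarHardy.functionW μ a K x * φ x ^ 2)
        (MultipolarHardy.weightMeasure μ) ∧
    MultipolarHardy.hardyConst N n K *
        ∫ x, MultipolarHardy.potentialV a x * φ x ^ 2 ∂(MultipolarHardy.weightMeasure μ) ≤
      ∫ x, ‖MultipolarHardy.weakGrad φ x‖ ^ 2 ∂(MultipolarHardy.weightMeasure μ) +
        ∫ x, MultipolarHardy.functionW μ a K x * φ x ^ 2 ∂(MultipolarHardy.weightMeasure μ) ∧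
    MultipolarHardy.hardyConst N n K *
        ∫ x, MultipolarHardy.potentialV a x * φ x ^ 2 ∂(MultipolarHardy.weightMeasure μ) ≤
      ∫ x, ‖MultipolarHardy.weakGrad φ x‖ ^ 2 ∂(MultipolarHardy.weightMeasure μ) +
        C * ∫ x, φ x ^ 2 ∂(MultipolarHardy.weightMeasure μ) := by
  obtain ⟨hφL2, g, hg, hgL2⟩ := hφ
  have hμm := h1.aemeasurable
  have hφ2 : Integrable (fun x => φ x ^ 2) (MultipolarHardy.weightMeasure μ) :=
    hφL2.integrable_sq
  have hg2 : Integrable (fun x => ‖g x‖ ^ 2) (MultipolarHardy.weightMeasure μ) :=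
    hgL2.integrable_norm_pow two_ne_zero
  obtain ⟨hV, hW, hle⟩ := MultipolarHardy.hardy_inequality_volume hN hn h1 h2 hg
    ((MultipolarHardy.integrable_weightMeasure_iff hμm _).1 hφ2)
    ((MultipolarHardy.integrable_weightMeasure_iff hμm _).1 hg2)
  have hV' := (MultipolarHardy.integrable_weightMeasure_iff hμm _).2 hV
  have hW' := (MultipolarHardy.integrable_weightMeasure_iff hμm _).2 hW
  have hgrad : ∫ x, ‖MultipolarHardy.weakGrad φ x‖ ^ 2 ∂(MultipolarHardy.weightMeasure μ)
      = ∫ x, Real.sqrt (μ x) ^ 2 * ‖g x‖ ^ 2 := by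
    rw [MultipolarHardy.integral_weightMeasure hμm]
    refine integral_congr_ae ?_
    filter_upwards [MultipolarHardy.weakGrad_ae_eq hg] with x hx
    rw [hx]
  have hmain : MultipolarHardy.hardyConst N n K *
        ∫ x, MultipolarHardy.potentialV a x * φ x ^ 2 ∂(MultipolarHardy.weightMeasure μ) ≤
      ∫ x, ‖MultipolarHardy.weakGrad φ x‖ ^ 2 ∂(MultipolarHardy.weightMeasure μ) +
        ∫ x, MultipolarHardy.functionW μ a K x * φ x ^ 2
          ∂(MultipolarHardy.weightMeasure μ) := by
    rw [hgrad, MultipolarHardy.integral_weightMeasure hμm,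
      MultipolarHardy.integral_weightMeasure hμm, MultipolarHardy.hardyConst, ← div_pow]
    exact hle
  refine ⟨hV', hW', hmain, hmain.trans (add_le_add_right ?_ _)⟩
  rw [← integral_const_mul]
  refine integral_mono_ae hW' (hφ2.const_mul C) ?_
  have hac : ∀ᵐ x ∂(MultipolarHardy.weightMeasure μ), MultipolarHardy.functionW μ a K x ≤ C :=
    (withDensity_absolutelyContinuous _ _).ae_le h2.W_le
  filter_upwards [hac] with x hx
  exact mul_le_mul_of_nonneg_right hx (sq_nonneg _)
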